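/- Setting. Let $N$ be the number of antennas, $M$ the number of users and $L\le N$ the number of antennas that may be active. Let $H=[h_1,\dots,h_M]\in\mathbb C^{N\times M}$, and for each user $m$ let $\sigma_m>0$, $\gamma_m>0$. For a beamforming matrix $W=[w_1,\dots,w_M]\in\mathbb C^{N\times M}$ and $h\in\mathbb C^N$ put $$\mathrm{SINR}_m(W,h)=\frac{|w_m^H h|^2}{\sum_{\ell\ne m}|w_\ell^H h|^2+\sigma_m^2}.$$ In the perfect-CSI case (BF) let $\mathcal C_m(W)=\mathrm{SINR}_m(W,h_m)$. In the imperfect-CSI case (RBF) let, in addition, $\varepsilon_m>0$ for all $m$, $\mathcal U_m=\{h_m+e:\|e\|_2\le\varepsilon_m\}$ and $\mathcal C_m(W)=\min_{\bar h\in\mathcal U_m}\mathrm{SINR}_m(W,\bar h)$. A node is a pair of disjoint sets $\mathcal A,\mathcal B\subseteq[N]$ (activated and shut-down antennas) with $|\mathcal A|\le L$ and $|\mathcal B|\le N-L$. The node problem is $$\min_W\|W\|_F^2\quad\text{s.t. } \mathcal C_m(W)\ge\gamma_m\ \forall m,\quad W(n,:)=0\ \forall n\in\mathcal B,\quad \|W\|_{\text{row-}0}\le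 L,$$ where $\|W\|_{\text{row-}0}$ is the number of nonzero rows. For $\mathcal B'\subseteq[N]$ let $(R_{\mathcal B'})$ be the problem $$\min_W\|W\|_F^2\quad\text{s.t. } \mathcal C_m(W)\ge\gamma_m\ \forall m,\quad W(n,:)=0\ \forall n\in\mathcal B';$$ $(R_{\mathcal B})$ is the node relaxation. The optimal value of an infeasible problem is $+\infty$. (a) In the BF case, for every node, $(R_{\mathcal B})$ is solved optimally by the second-order cone program in $(W,t)\in\mathbb C^{N\times M}\times\mathbb R$ $$\min\ t\quad\text{s.t. }\|(2W,\,t-1)\|_2\le t+1,\quad \sqrt{\textstyle\sum_{\ell\ne m}|w_\ell^Hh_m|^2/\sigma_m^2+1}\le\frac{\mathrm{Re}(w_m^Hh_m)}{\sqrt{\gamma_m\sigma_m^2}}\ \forall m,\quad W(n,:)=0\ \forall n\in\mathcal B$$ (the first constraint says $\|W\|_F^2\le t$). That is: the two problems have the same optimal value; if $(R_{\mathcal B})$ is feasible, the cone program has an optimal solution; and for each optimal solution $(W,t)$ of the cone program, $W$ is an optimal solution of $(R_{\mathcal B})$. (b) In the RBF case, assume that for every $\mathcal S\subseteq[N]$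 with $|\mathcal S|\ge L$, the matrix $\widetilde H=H(\mathcal S,:)$ with columns $\tilde h_m$ satisfies, for all $m$, $$\frac{\|\Pi_m\tilde h_m\|_2^2}{\varepsilon_m^2}>1+M+\Bigl(M-\frac1M\Bigr)\gamma_m,\qquad \Pi_m=I-\widetilde H_{-m}(\widetilde H_{-m}^H\widetilde H_{-m})^{-1}\widetilde H_{-m}^H,$$ where $\widetilde H_{-m}$ is $\widetilde H$ without column $m$ and the inverse is assumed to exist. Then, for every node, $(R_{\mathcal B})$ is solved optimally by its semidefinite relaxation $$\min_{X_1,\dots,X_M\succeq0}\ \sum_m\mathrm{Tr}(X_m)\quad\text{s.t. }\min_{\bar h\in\mathcal U_m}\frac{\bar h^HX_m\bar h}{\sum_{j\ne m}\bar h^HX_j\bar h+\sigma_m^2}\ge\gamma_m,\quad X_m(n,:)=0\ \forall n\in\mathcal B,\ \forall m.$$ That is: the two problems have the same optimal value; if $(R_{\mathcal B})$ is feasible, the semidefinite relaxation has an optimal solution; and each of its optimal solutions satisfies $\mathrm{rank}\,X_m=1$ for all $m$, can be written as $X_m=w_mw_m^H$, and every $W=[w_1,\dots,w_M]$ with $X_m=w_mw_m^H$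 for all $m$ is an optimal solution of $(R_{\mathcal B})$. (c) In the BF case, and in the RBF case under the assumption of (b), let $W$ be an optimal solution of $(R_{\mathcal B})$ at a node. Then there is a set $\mathcal C\subseteq[N]\setminus(\mathcal A\cup\mathcal B)$ of undecided antennas with $|\mathcal C\cup\mathcal B|=N-L$ whose powers $\|W(i,:)\|_2^2$ are lowest, i.e. $\|W(i,:)\|_2^2\le\|W(j,:)\|_2^2$ for all $i\in\mathcal C$ and all undecided $j\notin\mathcal C$. For every such $\mathcal C$, with $\widetilde{\mathcal B}=\mathcal C\cup\mathcal B$, the problem $(R_{\widetilde{\mathcal B}})$ is solved optimally by its second-order cone program (BF) or its semidefinite relaxation (RBF) in the sense of (a) and (b), its feasible points are feasible for the node problem, and its optimal value is an upper bound of the optimal value of the node problem. -/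

import Mathlib

noncomputable section

namespace AntennaSelection

open Matrix
open scoped ComplexOrder

/-! ### Optimization problems -/

/-- `x` solves `minimize f over S`. -/
def IsOptimal {X : Type*} (f : X → ℝ) (S : Set X) (x : X) : Prop :=
  x ∈ S ∧ IsMinOn f S x

/-- The optimal value of `minimize f over S`; it is `+∞` when `S` is empty. -/
def optValue {X : Type*} (f : X → ℝ) (S : Set X) : EReal :=
  ⨅ x ∈ S, ((f x : ℝ) : EReal)

/-- A second-order cone constraint `‖A x + b‖₂ ≤ c x + d` on a real vector space `V`, where the
linear map `A` and the vector `b` are given row by row. -/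
structure SOCConstraint (V : Type*) [AddCommGroup V] [Module ℝ V] where
  Row : Type
  [finRow : Fintype Row]
  A : Row → V →ₗ[ℝ] ℝ
  b : Row → ℝ
  c : V →ₗ[ℝ] ℝ
  d : ℝ

attribute [instance] SOCConstraint.finRow

def SOCConstraint.Holds {V : Type*} [AddCommGroup V] [Module ℝ V] (K : SOCConstraint V)
    (x : V) : Prop :=
  √(∑ k, (K.A k x + K.b k) ^ 2) ≤ K.c x + K.d

/-- A second-order cone program on a finite-dimensional real vector space `V`: minimize a linear
functional subject to finitely many second-order cone constraints and finitely many linear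
equations `F j x = g j`. -/
structure SOCP (V : Type*) [AddCommGroup V] [Module ℝ V] [FiniteDimensional ℝ V] where
  Cone : Type
  [finCone : Fintype Cone]
  Eqn : Type
  [finEqn : Fintype Eqn]
  obj : V →ₗ[ℝ] ℝ
  cone : Cone → SOCConstraint V
  F : Eqn → V →ₗ[ℝ] ℝ
  g : Eqn → ℝ

def SOCP.feasible {V : Type*} [AddCommGroup V] [Module ℝ V] [FiniteDimensional ℝ V]
    (P : SOCP V) : Set V :=
  {x | (∀ i, (P.cone i).Holds x) ∧ ∀ j, P.F j x = P.g j}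

/-! ### Beamforming -/

/-- Euclidean norm of a complex vector. -/
def l2 {ι : Type*} [Fintype ι] (x : ι → ℂ) : ℝ :=
  ‖(WithLp.toLp 2 x : EuclideanSpace ℂ ι)‖

/-- Data of a downlink scenario with `N` antennas and `M` users: column `m` of `H` is the (exact or
approximate) channel of user `m`, `ε m` the bound on the channel error, `σ m ^ 2` the noise
variance and `γ m` the required SINR. -/
structure Scenario (N M : ℕ) where
  H : Matrix (Fin N) (Fin M) ℂ
  ε : Fin M → ℝ
  σ : Fin M → ℝ
  γ : Fin M → ℝ

/-- `BF`: perfect channel state information. `RBF`: imperfect channel state information. -/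
inductive CSI
  | BF
  | RBF

variable {N M L : ℕ}

/-- `‖W‖_F²`. -/
def power (W : Matrix (Fin N) (Fin M) ℂ) : ℝ :=
  ∑ n, ∑ m, ‖W n m‖ ^ 2

/-- The number of nonzero rows. -/
def rowZero (W : Matrix (Fin N) (Fin M) ℂ) : ℕ :=
  {n | W n ≠ 0}.ncard

/-- `w_ℓᴴ h`, where `w_ℓ` is column `ℓ` of `W`. -/
def gain (W : Matrix (Fin N) (Fin M) ℂ) (l : Fin M) (h : Fin N → ℂ) : ℂ :=
  star (W.col l) ⬝ᵥ h

/-- SINR of user `m` if its channel is `h`. -/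
def sinr (D : Scenario N M) (W : Matrix (Fin N) (Fin M) ℂ) (m : Fin M) (h : Fin N → ℂ) : ℝ :=
  ‖gain W m h‖ ^ 2 / (∑ l ∈ Finset.univ.erase m, ‖gain W l h‖ ^ 2 + D.σ m ^ 2)

/-- `U_m = {h_m + e : ‖e‖₂ ≤ ε_m}`. -/
def uncertainty (D : Scenario N M) (m : Fin M) : Set (Fin N → ℂ) :=
  {h | ∃ e : Fin N → ℂ, l2 e ≤ D.ε m ∧ h = D.H.col m + e}

/-- The quality of service of user `m`: its SINR, or its worst-case SINR over `U_m`. -/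
def qos (D : Scenario N M) (c : CSI) (W : Matrix (Fin N) (Fin M) ℂ) (m : Fin M) : ℝ :=
  match c with
  | .BF => sinr D W m (D.H.col m)
  | .RBF => ⨅ h : uncertainty D m, sinr D W m h

/-- Feasible set of the node relaxation: the rows in `B` are zero, no cardinality constraint. -/
def relaxFeasible (D : Scenario N M) (c : CSI) (B : Finset (Fin N)) :
    Set (Matrix (Fin N) (Fin M) ℂ) :=
  {W | (∀ m, D.γ m ≤ qos D c W m) ∧ ∀ n ∈ B, W n = 0}

/-- A node of the branch-and-bound tree: disjoint sets of activated and of shut-down antennas, of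
which there are at most `L` and at most `N - L`, respectively. -/
structure Node (N L : ℕ) where
  A : Finset (Fin N)
  B : Finset (Fin N)
  disjoint : Disjoint A B
  card_A : A.card ≤ L
  card_B : B.card + L ≤ N

/-- Feasible set of the problem at a node. (The rows of activated antennas are unrestricted.) -/
def nodeFeasible (D : Scenario N M) (c : CSI) (ν : Node N L) :
    Set (Matrix (Fin N) (Fin M) ℂ) :=
  {W | (∀ m, D.γ m ≤ qos D c W m) ∧ (∀ n ∈ ν.B, W n = 0) ∧ rowZero W ≤ L}

/-! ### The second-order cone program -/

/-- Variables `(W, t)` of the second-order cone program. -/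
abbrev SOCPVar (N M : ℕ) : Type := Matrix (Fin N) (Fin M) ℂ × ℝ

/-- `(W, t) ↦ Re (w_ℓᴴ h)`. -/
def gainRe (l : Fin M) (h : Fin N → ℂ) : SOCPVar N M →ₗ[ℝ] ℝ where
  toFun x := (gain x.1 l h).re
  map_add' x y := by simp [gain, dotProduct, Matrix.col, add_mul, Finset.sum_add_distrib]
  map_smul' r x := by
    simp [gain, dotProduct, Matrix.col, Finset.mul_sum, mul_assoc]

/-- `(W, t) ↦ Im (w_ℓᴴ h)`. -/
def gainIm (l : Fin M) (h : Fin N → ℂ) : SOCPVar N M →ₗ[ℝ] ℝ where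
  toFun x := (gain x.1 l h).im
  map_add' x y := by simp [gain, dotProduct, Matrix.col, add_mul, Finset.sum_add_distrib]
  map_smul' r x := by
    simp [gain, dotProduct, Matrix.col, Finset.mul_sum, mul_assoc, mul_add]

/-- `(W, t) ↦ Re W(n,m)`. -/
def entryRe (n : Fin N) (m : Fin M) : SOCPVar N M →ₗ[ℝ] ℝ where
  toFun x := (x.1 n m).re
  map_add' x y := by simp
  map_smul' r x := by simp

/-- `(W, t) ↦ Im W(n,m)`. -/
def entryIm (n : Fin N) (m : Fin M) : SOCPVar N M →ₗ[ℝ] ℝ where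
  toFun x := (x.1 n m).im
  map_add' x y := by simp
  map_smul' r x := by simp

/-- The cone constraint `‖(2 W, t - 1)‖₂ ≤ t + 1`, that is, `‖W‖_F² ≤ t`. -/
def epigraphCone (N M : ℕ) : SOCConstraint (SOCPVar N M) where
  Row := (Fin N × Fin M) ⊕ (Fin N × Fin M) ⊕ Unit
  A
    | .inl p => (2 : ℝ) • entryRe p.1 p.2
    | .inr (.inl p) => (2 : ℝ) • entryIm p.1 p.2
    | .inr (.inr _) => LinearMap.snd ℝ _ _
  b
    | .inl _ => 0
    | .inr (.inl _) => 0
    | .inr (.inr _) => -1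
  c := LinearMap.snd ℝ _ _
  d := 1

/-- The cone constraint
`√(∑_{ℓ ≠ m} |w_ℓᴴ h_m|² / σ_m² + 1) ≤ Re (w_mᴴ h_m) / √(γ_m σ_m²)`. -/
def sinrCone (D : Scenario N M) (m : Fin M) : SOCConstraint (SOCPVar N M) where
  Row := {l : Fin M // l ≠ m} ⊕ {l : Fin M // l ≠ m} ⊕ Unit
  A
    | .inl l => (D.σ m)⁻¹ • gainRe l.1 (D.H.col m)
    | .inr (.inl l) => (D.σ m)⁻¹ • gainIm l.1 (D.H.col m)
    | .inr (.inr _) => 0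
  b
    | .inl _ => 0
    | .inr (.inl _) => 0
    | .inr (.inr _) => 1
  c := (1 / √(D.γ m * D.σ m ^ 2)) • gainRe m (D.H.col m)
  d := 0

/-- The second-order cone program: minimize `t` subject to `‖W‖_F² ≤ t`, the SINR cone constraints
and `W(n,:) = 0` for `n ∈ B`. -/
def nodeSOCP (D : Scenario N M) (B : Finset (Fin N)) : SOCP (SOCPVar N M) where
  Cone := Option (Fin M)
  Eqn := (B × Fin M) ⊕ (B × Fin M)
  obj := LinearMap.snd ℝ _ _
  cone
    | none => epigraphCone N M
    | some m => sinrCone D m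
  F
    | .inl p => entryRe p.1.1 p.2
    | .inr p => entryIm p.1.1 p.2
  g _ := 0

/-- The perfect-CSI relaxation with excluded antennas `B` is solved optimally by the second-order
cone program: both have the same optimal value (`+∞` if infeasible), the program attains its
optimum whenever the relaxation is feasible, and the `W`-part of each of its optimal solutions is
an optimal solution of the relaxation. -/
def SolvedBySOCP (D : Scenario N M) (B : Finset (Fin N)) : Prop :=
  optValue power (relaxFeasible D .BF B) =
      optValue (nodeSOCP D B).obj (nodeSOCP D B).feasible ∧
  ((relaxFeasible D .BF B).Nonempty →
      ∃ x, IsOptimal (nodeSOCP D B).obj (nodeSOCP D B).feasible x) ∧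
  ∀ x, IsOptimal (nodeSOCP D B).obj (nodeSOCP D B).feasible x →
      IsOptimal power (relaxFeasible D .BF B) x.1

/-! ### The semidefinite relaxation -/

/-- `hᴴ X h` (a real number for Hermitian `X`). -/
def quad (X : Matrix (Fin N) (Fin N) ℂ) (h : Fin N → ℂ) : ℝ :=
  (star h ⬝ᵥ (X *ᵥ h)).re

/-- Worst-case SINR of user `m` for transmit covariances `X_1, …, X_M`. -/
def sdrQos (D : Scenario N M) (X : Fin M → Matrix (Fin N) (Fin N) ℂ) (m : Fin M) : ℝ :=
  ⨅ h : uncertainty D m,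
    quad (X m) h / (∑ j ∈ Finset.univ.erase m, quad (X j) h + D.σ m ^ 2)

/-- Objective of the semidefinite relaxation. -/
def sdrPower (X : Fin M → Matrix (Fin N) (Fin N) ℂ) : ℝ :=
  ∑ m, (X m).trace.re

/-- Feasible set of the semidefinite relaxation with excluded antennas `B`, obtained from the
imperfect-CSI node relaxation by replacing `w_m w_mᴴ` by an arbitrary positive semidefinite `X_m`.
(Since `X_m` is Hermitian, its columns in `B` vanish with the rows.) -/
def sdrFeasible (D : Scenario N M) (B : Finset (Fin N)) :
    Set (Fin M → Matrix (Fin N) (Fin N) ℂ) :=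
  {X | (∀ m, (X m).PosSemidef) ∧ (∀ m, D.γ m ≤ sdrQos D X m) ∧ ∀ m, ∀ n ∈ B, X m n = 0}

/-- The matrices `w_m w_mᴴ`. -/
def outer (W : Matrix (Fin N) (Fin M) ℂ) : Fin M → Matrix (Fin N) (Fin N) ℂ :=
  fun m => vecMulVec (W.col m) (star (W.col m))

/-- The imperfect-CSI relaxation with excluded antennas `B` is solved optimally by its semidefinite
relaxation: both have the same optimal value, the latter attains its optimum whenever the former is
feasible, and each optimal solution of the latter consists of matrices of rank one and factors as
`w_m w_mᴴ`, where every such factorization is an optimal solution of the former. -/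
def SolvedBySDR (D : Scenario N M) (B : Finset (Fin N)) : Prop :=
  optValue power (relaxFeasible D .RBF B) = optValue sdrPower (sdrFeasible D B) ∧
  ((relaxFeasible D .RBF B).Nonempty → ∃ X, IsOptimal sdrPower (sdrFeasible D B) X) ∧
  ∀ X, IsOptimal sdrPower (sdrFeasible D B) X →
      (∀ m, (X m).rank = 1) ∧
      (∃ W, outer W = X) ∧
      ∀ W, outer W = X → IsOptimal power (relaxFeasible D .RBF B) W

/-! ### The channel condition -/

/-- `H̃ = H(S,:)`. -/
def subChannel (D : Scenario N M) (S : Finset (Fin N)) : Matrix S (Fin M) ℂ :=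
  D.H.submatrix (fun n => n.1) id

/-- `H̃_{-m}`: column `m` removed. -/
def removeCol {ι : Type*} (H : Matrix ι (Fin M) ℂ) (m : Fin M) :
    Matrix ι {j : Fin M // j ≠ m} ℂ :=
  H.submatrix id (fun j => j.1)

/-- `Π_m = I - H̃_{-m} (H̃_{-m}ᴴ H̃_{-m})⁻¹ H̃_{-m}ᴴ`. -/
def complProj {ι : Type*} [Fintype ι] [DecidableEq ι] (H : Matrix ι (Fin M) ℂ) (m : Fin M) :
    Matrix ι ι ℂ :=
  1 - removeCol H m * ((removeCol H m)ᴴ * removeCol H m)⁻¹ * (removeCol H m)ᴴ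

/-- For every row subset with at least `L` rows and every user `m`, the inverse in `Π_m` exists and
`‖Π_m h̃_m‖² / ε_m² > 1 + M + (M - 1/M) γ_m`. -/
def ChannelCondition (D : Scenario N M) (L : ℕ) : Prop :=
  ∀ S : Finset (Fin N), L ≤ S.card → ∀ m : Fin M,
    IsUnit ((removeCol (subChannel D S) m)ᴴ * removeCol (subChannel D S) m).det ∧
    l2 (complProj (subChannel D S) m *ᵥ (subChannel D S).col m) ^ 2 / D.ε m ^ 2 >
      1 + (M : ℝ) + ((M : ℝ) - 1 / (M : ℝ)) * D.γ m

/-! ### The upper bound -/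

/-- `C` is a set of undecided antennas that together with `B` makes up `N - L` antennas, and no
other undecided antenna has less power in `W` than an antenna in `C`. -/
def IsLowestPower (ν : Node N L) (W : Matrix (Fin N) (Fin M) ℂ) (C : Finset (Fin N)) : Prop :=
  Disjoint C (ν.A ∪ ν.B) ∧ (C ∪ ν.B).card = N - L ∧
    ∀ i ∈ C, ∀ j, j ∉ C → j ∉ ν.A ∪ ν.B → l2 (W i) ^ 2 ≤ l2 (W j) ^ 2

/-- For each optimal solution `W` of the relaxation at the node, a choice of lowest-power undecided
antennas exists, and for each such choice the relaxation with the enlarged set of excluded antennas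
is solved by the method `Solved`, its optimal value is an upper bound of the optimal value of the
problem at the node, and its feasible points are feasible for the problem at the node. -/
def ValidUpperBound (D : Scenario N M) (c : CSI) (ν : Node N L)
    (Solved : Finset (Fin N) → Prop) : Prop :=
  ∀ W, IsOptimal power (relaxFeasible D c ν.B) W →
    (∃ C, IsLowestPower ν W C) ∧
    ∀ C, IsLowestPower ν W C →
      Solved (C ∪ ν.B) ∧
      optValue power (nodeFeasible D c ν) ≤ optValue power (relaxFeasible D c (C ∪ ν.B)) ∧
      relaxFeasible D c (C ∪ ν.B) ⊆ nodeFeasible D c ν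

end AntennaSelection

end

/-!
The SINR constraints do not depend on the phases of the columns of `W`, so in the perfect-CSI case
the useful gains can be taken real and nonnegative, which turns the constraints into second-order
cones.

In the imperfect-CSI case the semidefinite relaxation is a conic program with one inequality for
each channel in an uncertainty set. Its Lagrange multipliers are finite measures `μ m` on these
compact sets. Let `X` be an optimal solution. If some `X m` had rank at least two, its range would
contain a nonzero vector orthogonal to the mean of `μ m`; by complementary slackness the second
moment of `μ m` in this direction is at least the squared norm of the vector, so the variance of
`μ m` is at least one. On the other hand, the projections `Π_m h̃_m`, extended by zero to `B`, are
directions that cause no interference at the nominal channels of the other users. Testing dual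
feasibility on them and summing over the users, the channel condition shows that the variances of
all `μ m` add up to less than one. The same directions yield the Slater point that is needed for
the multipliers to exist.

For the upper bound, shutting down `N - L` antennas leaves at most `L` nonzero rows.
-/

noncomputable section

namespace AntennaSelection

open Matrix MeasureTheory
open scoped ComplexOrder CompactlySupported

variable {N M L : ℕ}

/-! ### Optimization -/

lemma optValue_le_optValue {X Y : Type*} {f : X → ℝ} {g : Y → ℝ} {S : Set X} {T : Set Y}
    (h : ∀ y ∈ T, ∃ x ∈ S, f x ≤ g y) : optValue f S ≤ optValue g T := by
  refine le_iInf₂ fun y hy => ?_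
  obtain ⟨x, hx, hxy⟩ := h y hy
  exact iInf₂_le_of_le x hx (EReal.coe_le_coe_iff.2 hxy)

lemma exists_isOptimal_of_isCompact {X : Type*} [TopologicalSpace X] {f : X → ℝ} {S : Set X}
    {x₀ : X} (hf : ContinuousOn f S) (hx₀ : x₀ ∈ S) (hS : IsCompact {x ∈ S | f x ≤ f x₀}) :
    ∃ x, IsOptimal f S x := by
  obtain ⟨x, ⟨hxS, hx⟩, hmin⟩ :=
    hS.exists_isMinOn ⟨x₀, hx₀, le_rfl⟩ (hf.mono (Set.sep_subset _ _))
  refine ⟨x, hxS, fun y hy => ?_⟩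
  rcases le_total (f y) (f x₀) with hyx₀ | hyx₀
  · exact hmin ⟨hy, hyx₀⟩
  · exact hx.trans hyx₀

/-! ### The second-order cone program -/

lemma complex_norm_sq (z : ℂ) : ‖z‖ ^ 2 = z.re ^ 2 + z.im ^ 2 := by
  rw [← Complex.sq_norm_sub_sq_re, add_sub_cancel]

lemma power_nonneg (W : Matrix (Fin N) (Fin M) ℂ) : 0 ≤ power W :=
  Finset.sum_nonneg fun _ _ => Finset.sum_nonneg fun _ _ => sq_nonneg _

lemma norm_apply_sq_le_power (W : Matrix (Fin N) (Fin M) ℂ) (n : Fin N) (m : Fin M) :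
    ‖W n m‖ ^ 2 ≤ power W :=
  (Finset.single_le_sum (f := fun m => ‖W n m‖ ^ 2) (fun _ _ => sq_nonneg _)
    (Finset.mem_univ m)).trans
  (Finset.single_le_sum (f := fun n => ∑ m, ‖W n m‖ ^ 2)
    (fun _ _ => Finset.sum_nonneg fun _ _ => sq_nonneg _) (Finset.mem_univ n))

lemma entryRe_apply (n : Fin N) (m : Fin M) (x : SOCPVar N M) :
    entryRe n m x = (x.1 n m).re := rfl

lemma entryIm_apply (n : Fin N) (m : Fin M) (x : SOCPVar N M) :
    entryIm n m x = (x.1 n m).im := rfl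

lemma gainRe_apply (l : Fin M) (h : Fin N → ℂ) (x : SOCPVar N M) :
    gainRe l h x = (gain x.1 l h).re := rfl

lemma gainIm_apply (l : Fin M) (h : Fin N → ℂ) (x : SOCPVar N M) :
    gainIm l h x = (gain x.1 l h).im := rfl

lemma sum_epigraphCone_sq (x : SOCPVar N M) :
    ∑ k, ((epigraphCone N M).A k x + (epigraphCone N M).b k) ^ 2 =
      4 * power x.1 + (x.2 - 1) ^ 2 := by
  change ∑ k : (Fin N × Fin M) ⊕ (Fin N × Fin M) ⊕ Unit, _ = _
  rw [Fintype.sum_sum_type, Fintype.sum_sum_type]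
  simp only [epigraphCone, power, complex_norm_sq, LinearMap.smul_apply, entryRe_apply,
    entryIm_apply, smul_eq_mul, add_zero, LinearMap.snd_apply, Finset.univ_unique,
    Finset.sum_singleton, Fintype.sum_prod_type, mul_pow, Finset.sum_add_distrib, ← Finset.mul_sum]
  ring

lemma epigraphCone_holds_iff (x : SOCPVar N M) :
    (epigraphCone N M).Holds x ↔ power x.1 ≤ x.2 := by
  have hrhs : (epigraphCone N M).c x + (epigraphCone N M).d = x.2 + 1 := rfl
  have hpower := power_nonneg x.1
  rw [SOCConstraint.Holds, sum_epigraphCone_sq, hrhs, Real.sqrt_le_iff]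
  refine ⟨fun h => ?_, fun h => ⟨?_, ?_⟩⟩ <;> linarith

lemma sum_sinrCone_sq (D : Scenario N M) (m : Fin M) (x : SOCPVar N M) :
    ∑ k, ((sinrCone D m).A k x + (sinrCone D m).b k) ^ 2 =
      (D.σ m ^ 2)⁻¹ * (∑ l ∈ Finset.univ.erase m, ‖gain x.1 l (D.H.col m)‖ ^ 2) + 1 := by
  have hothers : ∑ l ∈ Finset.univ.erase m, ‖gain x.1 l (D.H.col m)‖ ^ 2 =
      ∑ l : {l : Fin M // l ≠ m}, ‖gain x.1 l (D.H.col m)‖ ^ 2 :=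
    Finset.sum_subtype _ (by simp) _
  change ∑ k : {l : Fin M // l ≠ m} ⊕ {l : Fin M // l ≠ m} ⊕ Unit, _ = _
  rw [Fintype.sum_sum_type, Fintype.sum_sum_type, hothers]
  simp only [sinrCone, gainRe_apply, gainIm_apply, complex_norm_sq, LinearMap.smul_apply,
    smul_eq_mul, add_zero, LinearMap.zero_apply, zero_add, one_pow, Finset.univ_unique,
    Finset.sum_singleton, mul_pow, Finset.sum_add_distrib, ← Finset.mul_sum, inv_pow]
  ring

lemma sinrCone_holds_iff (D : Scenario N M) {m : Fin M} (hσ : 0 < D.σ m) (hγ : 0 < D.γ m)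
    (x : SOCPVar N M) :
    (sinrCone D m).Holds x ↔ 0 ≤ (gain x.1 m (D.H.col m)).re ∧
      D.γ m * (∑ l ∈ Finset.univ.erase m, ‖gain x.1 l (D.H.col m)‖ ^ 2 + D.σ m ^ 2) ≤
        (gain x.1 m (D.H.col m)).re ^ 2 := by
  have hrhs : (sinrCone D m).c x + (sinrCone D m).d =
      1 / √(D.γ m * D.σ m ^ 2) * (gain x.1 m (D.H.col m)).re := by
    simp [sinrCone, gainRe_apply]
  have hpos : 0 < D.γ m * D.σ m ^ 2 := by positivity
  rw [SOCConstraint.Holds, sum_sinrCone_sq, hrhs, Real.sqrt_le_iff,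
    mul_nonneg_iff_of_pos_left (one_div_pos.2 (Real.sqrt_pos.2 hpos)), mul_pow, div_pow,
    Real.sq_sqrt hpos.le, one_pow, one_div_mul_eq_div, le_div_iff₀ hpos]
  field_simp

lemma nodeSOCP_eqns_iff (D : Scenario N M) (B : Finset (Fin N)) (x : SOCPVar N M) :
    (∀ j, (nodeSOCP D B).F j x = (nodeSOCP D B).g j) ↔ ∀ n ∈ B, x.1 n = 0 := by
  constructor
  · intro h n hn
    funext m
    exact Complex.ext (h (.inl (⟨n, hn⟩, m))) (h (.inr (⟨n, hn⟩, m)))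
  · rintro h (⟨⟨n, hn⟩, m⟩ | ⟨⟨n, hn⟩, m⟩) <;>
      simp [nodeSOCP, entryRe_apply, entryIm_apply, h n hn]

lemma mem_nodeSOCP_feasible_iff (D : Scenario N M) (hσ : ∀ m, 0 < D.σ m) (hγ : ∀ m, 0 < D.γ m)
    (B : Finset (Fin N)) (x : SOCPVar N M) :
    x ∈ (nodeSOCP D B).feasible ↔ power x.1 ≤ x.2 ∧
      (∀ m, 0 ≤ (gain x.1 m (D.H.col m)).re ∧
        D.γ m * (∑ l ∈ Finset.univ.erase m, ‖gain x.1 l (D.H.col m)‖ ^ 2 + D.σ m ^ 2) ≤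
          (gain x.1 m (D.H.col m)).re ^ 2) ∧
      ∀ n ∈ B, x.1 n = 0 := by
  have hcones : (∀ i, ((nodeSOCP D B).cone i).Holds x) ↔
      (epigraphCone N M).Holds x ∧ ∀ m, (sinrCone D m).Holds x :=
    Option.forall
  rw [SOCP.feasible, Set.mem_ofPred_eq, hcones, nodeSOCP_eqns_iff, epigraphCone_holds_iff,
    and_assoc]
  simp only [fun m => sinrCone_holds_iff D (hσ m) (hγ m) x]

lemma le_sinr_iff (D : Scenario N M) {m : Fin M} (hσ : 0 < D.σ m)
    (W : Matrix (Fin N) (Fin M) ℂ) (h : Fin N → ℂ) (c : ℝ) :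
    c ≤ sinr D W m h ↔
      c * (∑ l ∈ Finset.univ.erase m, ‖gain W l h‖ ^ 2 + D.σ m ^ 2) ≤ ‖gain W m h‖ ^ 2 :=
  le_div_iff₀ (add_pos_of_nonneg_of_pos (Finset.sum_nonneg fun _ _ => sq_nonneg _)
    (pow_pos hσ 2))

lemma mem_relaxFeasible_and_power_le (D : Scenario N M) (hσ : ∀ m, 0 < D.σ m)
    (hγ : ∀ m, 0 < D.γ m) (B : Finset (Fin N)) {x : SOCPVar N M}
    (hx : x ∈ (nodeSOCP D B).feasible) : x.1 ∈ relaxFeasible D .BF B ∧ power x.1 ≤ x.2 := by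
  obtain ⟨hpower, hsinr, hrows⟩ := (mem_nodeSOCP_feasible_iff D hσ hγ B x).1 hx
  refine ⟨⟨fun m => (le_sinr_iff D (hσ m) _ _ _).2 ((hsinr m).2.trans ?_), hrows⟩, hpower⟩
  rw [complex_norm_sq]
  exact le_add_of_nonneg_right (sq_nonneg _)

lemma exists_gain_re_eq_norm (D : Scenario N M) (W : Matrix (Fin N) (Fin M) ℂ) :
    ∃ W' : Matrix (Fin N) (Fin M) ℂ, (∀ n m, ‖W' n m‖ = ‖W n m‖) ∧
      (∀ l h, ‖gain W' l h‖ = ‖gain W l h‖) ∧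
      ∀ m, (gain W' m (D.H.col m)).re = ‖gain W m (D.H.col m)‖ := by
  choose θ hθ hθW using fun m => Complex.exists_norm_eq_mul_self (gain W m (D.H.col m))
  have hgain (l : Fin M) (h : Fin N → ℂ) :
      gain (Matrix.of fun n m => star (θ m) * W n m) l h = θ l * gain W l h := by
    simp [gain, dotProduct, Matrix.col, Finset.mul_sum, mul_assoc]
  refine ⟨Matrix.of fun n m => star (θ m) * W n m, fun n m => ?_, fun l h => ?_, fun m => ?_⟩
  · rw [Matrix.of_apply, norm_mul, norm_star, hθ, one_mul]
  · rw [hgain, norm_mul, hθ, one_mul]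
  · rw [hgain, ← hθW]
    exact Complex.ofReal_re _

lemma exists_mem_feasible_obj_eq_power (D : Scenario N M) (hσ : ∀ m, 0 < D.σ m)
    (hγ : ∀ m, 0 < D.γ m) (B : Finset (Fin N)) {W : Matrix (Fin N) (Fin M) ℂ}
    (hW : W ∈ relaxFeasible D .BF B) :
    ∃ x ∈ (nodeSOCP D B).feasible, (nodeSOCP D B).obj x = power W := by
  obtain ⟨W', hnorm, hgain, hre⟩ := exists_gain_re_eq_norm D W
  have hpower : power W' = power W := by simp only [power, hnorm]
  refine ⟨(W', power W),
    (mem_nodeSOCP_feasible_iff D hσ hγ B _).2 ⟨hpower.le, fun m => ?_, fun n hn => ?_⟩, rfl⟩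
  · simp only [hgain, hre]
    exact ⟨norm_nonneg _, (le_sinr_iff D (hσ m) _ _ _).1 (hW.1 m)⟩
  · funext m
    rw [Pi.zero_apply, ← norm_eq_zero, hnorm, hW.2 n hn, Pi.zero_apply, norm_zero]

lemma isCompact_power_le (r : ℝ) :
    IsCompact {x : SOCPVar N M | power x.1 ≤ x.2 ∧ x.2 ≤ r} := by
  have hbox : IsCompact ((Set.univ.pi fun _ : Fin N => Set.univ.pi fun _ : Fin M =>
      Metric.closedBall (0 : ℂ) √r) ×ˢ Set.Icc (0 : ℝ) r) :=
    (isCompact_univ_pi fun _ => isCompact_univ_pi fun _ => isCompact_closedBall _ _).prod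
      isCompact_Icc
  refine hbox.of_isClosed_subset ?_ ?_
  · refine IsClosed.and (isClosed_le ?_ continuous_snd) (isClosed_le continuous_snd (by fun_prop))
    unfold power
    fun_prop
  · rintro ⟨W, t⟩ ⟨hWt, htr⟩
    refine ⟨fun n _ m _ => ?_, (power_nonneg W).trans hWt, htr⟩
    rw [mem_closedBall_zero_iff]
    exact Real.le_sqrt_of_sq_le ((norm_apply_sq_le_power W n m).trans (hWt.trans htr))

lemma isClosed_feasible {V : Type*} [AddCommGroup V] [Module ℝ V] [TopologicalSpace V]
    [IsTopologicalAddGroup V] [ContinuousSMul ℝ V] [T2Space V] [FiniteDimensional ℝ V]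
    (P : SOCP V) : IsClosed P.feasible := by
  have hcont (f : V →ₗ[ℝ] ℝ) : Continuous f := f.continuous_of_finiteDimensional
  simp only [SOCP.feasible, Set.ofPred_and, Set.ofPred_forall]
  refine (isClosed_iInter fun i => isClosed_le ?_ ((hcont _).add continuous_const)).inter
    (isClosed_iInter fun j => isClosed_eq (hcont _) continuous_const)
  exact Real.continuous_sqrt.comp
    (continuous_finsetSum _ fun k _ => ((hcont _).add continuous_const).pow 2)

theorem solvedBySOCP (D : Scenario N M) (hσ : ∀ m, 0 < D.σ m) (hγ : ∀ m, 0 < D.γ m)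
    (B : Finset (Fin N)) : SolvedBySOCP D B := by
  refine ⟨le_antisymm ?_ ?_, ?_, ?_⟩
  · exact optValue_le_optValue fun x hx =>
      ⟨x.1, mem_relaxFeasible_and_power_le D hσ hγ B hx⟩
  · exact optValue_le_optValue fun W hW =>
      (exists_mem_feasible_obj_eq_power D hσ hγ B hW).imp fun x hx => ⟨hx.1, hx.2.le⟩
  · rintro ⟨W, hW⟩
    obtain ⟨x₀, hx₀, -⟩ := exists_mem_feasible_obj_eq_power D hσ hγ B hW
    refine exists_isOptimal_of_isCompact continuous_snd.continuousOn hx₀ ?_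
    refine (isCompact_power_le x₀.2).of_isClosed_subset
      ((isClosed_feasible (nodeSOCP D B)).inter (isClosed_Iic.preimage continuous_snd)) ?_
    exact fun x hx => ⟨(mem_relaxFeasible_and_power_le D hσ hγ B hx.1).2, hx.2⟩
  · rintro x ⟨hx, hmin⟩
    obtain ⟨hW, hpower⟩ := mem_relaxFeasible_and_power_le D hσ hγ B hx
    refine ⟨hW, fun W' hW' => ?_⟩
    obtain ⟨y, hy, hyW⟩ := exists_mem_feasible_obj_eq_power D hσ hγ B hW'
    exact hpower.trans ((hmin hy).trans hyW.le)

/-! ### Lagrange duality -/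

section Duality

variable {E V : Type*} [AddCommGroup E] [Module ℝ E] [AddCommGroup V] [PartialOrder V]
  [IsOrderedAddMonoid V] [Module ℝ V] [PosSMulMono ℝ V]

/-- The pairs `(w, t)` for which the homogenization of the conic program `minimize p z` over
`z ∈ K` subject to `v ≤ A z`, perturbed by `w`, has a point of value at most `t`, where values are
measured relative to the value `r` of the unperturbed program. A linear functional
`(w, t) ↦ t - y w` that is nonnegative on this cone is a Lagrange multiplier `y`. -/
def perturbationCone (K : PointedCone ℝ E) (p : E →ₗ[ℝ] ℝ) (A : E →ₗ[ℝ] V) (v : V) (r : ℝ) :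
    PointedCone ℝ (V × ℝ) where
  carrier := {q | ∃ z ∈ K, ∃ τ : ℝ, 0 ≤ τ ∧ q.1 ≤ A z - τ • v ∧ p z - τ * r ≤ q.2}
  zero_mem' := ⟨0, K.zero_mem, 0, le_rfl, by simp, by simp⟩
  add_mem' := by
    rintro q q' ⟨z, hz, τ, hτ, hq, ht⟩ ⟨z', hz', τ', hτ', hq', ht'⟩
    refine ⟨z + z', K.add_mem hz hz', τ + τ', add_nonneg hτ hτ', ?_, ?_⟩
    · rw [map_add, add_smul, add_sub_add_comm]
      exact add_le_add hq hq'
    · rw [map_add, add_mul, add_sub_add_comm]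
      exact add_le_add ht ht'
  smul_mem' := by
    rintro ⟨c, hc⟩ q ⟨z, hz, τ, hτ, hq, ht⟩
    refine ⟨c • z, K.smul_mem hc hz, c * τ, mul_nonneg hc hτ, ?_, ?_⟩
    · rw [map_smul, mul_smul, ← smul_sub]
      exact smul_le_smul_of_nonneg_left hq hc
    · rw [map_smul, smul_eq_mul, mul_assoc, ← mul_sub]
      exact mul_le_mul_of_nonneg_left ht hc

variable {K : PointedCone ℝ E} {p : E →ₗ[ℝ] ℝ} {A : E →ₗ[ℝ] V} {v : V} {x : E}

lemma nonneg_of_mem_perturbationCone (hx : x ∈ K) (hxv : v ≤ A x)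
    (hmin : ∀ z ∈ K, v ≤ A z → p x ≤ p z) {q : V × ℝ} (hq₀ : q.1 = 0)
    (hq : q ∈ perturbationCone K p A v (p x)) : 0 ≤ q.2 := by
  obtain ⟨z, hz, τ, hτ, hzv, hzt⟩ := hq
  rw [hq₀, sub_nonneg] at hzv
  refine le_trans ?_ hzt
  rcases hτ.eq_or_lt with rfl | hτ
  · have hxz := hmin (x + z) (K.add_mem hx hz) (by
      rw [zero_smul] at hzv
      simpa using add_le_add hxv hzv)
    simpa using hxz
  · have hxz := hmin (τ⁻¹ • z) (K.smul_mem (inv_nonneg.2 hτ.le) hz) (by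
      simpa [smul_smul, hτ.ne'] using smul_le_smul_of_nonneg_left hzv (inv_nonneg.2 hτ.le))
    rw [map_smul, smul_eq_mul, le_inv_mul_iff₀ hτ] at hxz
    exact sub_nonneg.2 hxz

lemma exists_nonneg_on_perturbationCone (hx : x ∈ K) (hxv : v ≤ A x)
    (hmin : ∀ z ∈ K, v ≤ A z → p x ≤ p z) {x₀ : E} (hx₀ : x₀ ∈ K)
    (hunit : ∀ w, ∃ c : ℝ, 0 ≤ c ∧ w ≤ c • (A x₀ - v)) :
    ∃ y : V →ₗ[ℝ] ℝ, ∀ q ∈ perturbationCone K p A v (p x), y q.1 ≤ q.2 := by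
  let f : V × ℝ →ₗ.[ℝ] ℝ :=
    ⟨LinearMap.range (LinearMap.inr ℝ V ℝ), LinearMap.snd ℝ V ℝ ∘ₗ Submodule.subtype _⟩
  obtain ⟨g, hgf, hg⟩ := riesz_extension (perturbationCone K p A v (p x)) f
    (by
      rintro ⟨_, t, rfl⟩ ht
      exact nonneg_of_mem_perturbationCone hx hxv hmin rfl ht)
    (by
      rintro ⟨w, t⟩
      obtain ⟨c, hc, hw⟩ := hunit w
      refine ⟨⟨(0, c * (p x₀ - p x) - t), ⟨_, rfl⟩⟩, c • x₀, K.smul_mem hc hx₀, c, hc, ?_, ?_⟩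
      · simpa [smul_sub] using hw
      · simp [mul_sub])
  have hg₀ (t : ℝ) : g (0, t) = t := hgf ⟨(0, t), ⟨t, rfl⟩⟩
  refine ⟨-(g ∘ₗ LinearMap.inl ℝ V ℝ), fun q hq => ?_⟩
  have hgq : g q = g (q.1, 0) + q.2 := by
    rw [← hg₀ q.2, ← map_add]; simp
  have hq := hg q hq
  simp only [LinearMap.neg_apply, LinearMap.comp_apply, LinearMap.inl_apply]
  linarith

/-- `hunit` is Slater's condition: the slack of `x₀` is an order unit. -/
theorem exists_lagrange_multiplier (hx : x ∈ K) (hxv : v ≤ A x)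
    (hmin : ∀ z ∈ K, v ≤ A z → p x ≤ p z) {x₀ : E} (hx₀ : x₀ ∈ K)
    (hunit : ∀ w, ∃ c : ℝ, 0 ≤ c ∧ w ≤ c • (A x₀ - v)) :
    ∃ y : V →ₗ[ℝ] ℝ, (∀ w, 0 ≤ w → 0 ≤ y w) ∧ (∀ z ∈ K, y (A z) ≤ p z) ∧ y (A x) = p x := by
  obtain ⟨y, hy⟩ := exists_nonneg_on_perturbationCone hx hxv hmin hx₀ hunit
  have hpos (w : V) (hw : 0 ≤ w) : 0 ≤ y w := by
    simpa using hy (-w, 0) ⟨0, K.zero_mem, 0, le_rfl, by simpa using hw, by simp⟩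
  have hle (z : E) (hz : z ∈ K) : y (A z) ≤ p z :=
    hy (A z, p z) ⟨z, hz, 0, le_rfl, by simp, by simp⟩
  have hv : p x ≤ y v := by
    simpa using hy (-v, -p x) ⟨0, K.zero_mem, 1, zero_le_one, by simp, by simp⟩
  have hvA : y v ≤ y (A x) := by
    simpa using hpos (A x - v) (sub_nonneg.2 hxv)
  exact ⟨y, hpos, hle, (hle x hx).antisymm (hv.trans hvA)⟩

end Duality

/-! ### Measures -/

lemma exists_finiteMeasure_integral_eq {X : Type*} [TopologicalSpace X] [CompactSpace X]
    [T2Space X] [MeasurableSpace X] [BorelSpace X] {Λ : C(X, ℝ) →ₗ[ℝ] ℝ}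
    (hΛ : ∀ f, 0 ≤ f → 0 ≤ Λ f) : ∃ μ : FiniteMeasure X, ∀ f : C(X, ℝ), ∫ x, f x ∂μ = Λ f := by
  let Λ' : C_c(X, ℝ) →ₚ[ℝ] ℝ := PositiveLinearMap.mk₀
    { toFun f := Λ f.toContinuousMap
      map_add' f g := map_add Λ f.toContinuousMap g.toContinuousMap
      map_smul' c f := map_smul Λ c f.toContinuousMap }
    fun f hf => hΛ _ hf
  exact ⟨⟨RealRMK.rieszMeasure Λ', inferInstance⟩, fun f =>
    RealRMK.integral_rieszMeasure Λ' (CompactlySupportedContinuousMap.continuousMapEquiv f)⟩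

lemma integrable_of_continuous {X E : Type*} [TopologicalSpace X] [CompactSpace X]
    [MeasurableSpace X] [OpensMeasurableSpace X] [NormedAddCommGroup E] {f : X → E}
    (hf : Continuous f) (μ : Measure X) [IsFiniteMeasure μ] : Integrable f μ :=
  hf.integrable_of_hasCompactSupport (HasCompactSupport.of_compactSpace f)

lemma integral_norm_sub_sq {X E : Type*} [MeasurableSpace X] {μ : Measure X} [IsFiniteMeasure μ]
    [NormedAddCommGroup E] [InnerProductSpace ℝ E] [CompleteSpace E] {ξ : X → E}
    (hξ : MemLp ξ 2 μ) (a : E) :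
    ∫ x, ‖ξ x - a‖ ^ 2 ∂μ =
      ∫ x, ‖ξ x - ⨍ y, ξ y ∂μ‖ ^ 2 ∂μ + μ.real Set.univ * ‖⨍ y, ξ y ∂μ - a‖ ^ 2 := by
  set b := ⨍ y, ξ y ∂μ
  have hint : Integrable ξ μ := hξ.integrable one_le_two
  have hb : MemLp (fun x => ξ x - b) 2 μ := hξ.sub (memLp_const b)
  have hsq : Integrable (fun x => ‖ξ x - b‖ ^ 2) μ := hb.integrable_norm_pow two_ne_zero
  have hinner : Integrable (fun x => 2 * inner ℝ (b - a) (ξ x - b)) μ :=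
    ((hint.sub (integrable_const b)).const_inner (b - a)).const_mul 2
  have hzero : ∫ x, inner ℝ (b - a) (ξ x - b) ∂μ = 0 := by
    rw [integral_inner (f := fun x => ξ x - b) (hint.sub (integrable_const b)),
      integral_sub_average, inner_zero_right]
  calc ∫ x, ‖ξ x - a‖ ^ 2 ∂μ
      = ∫ x, (‖ξ x - b‖ ^ 2 + 2 * inner ℝ (b - a) (ξ x - b) + ‖b - a‖ ^ 2) ∂μ := by
        congr with x
        rw [← sub_add_sub_cancel (ξ x) b a, norm_add_sq_real, real_inner_comm]
    _ = ∫ x, ‖ξ x - b‖ ^ 2 ∂μ + μ.real Set.univ * ‖b - a‖ ^ 2 := by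
        rw [integral_add (by exact hsq.add hinner) (integrable_const _), integral_add hsq hinner,
          integral_const_mul, hzero, mul_zero, add_zero, integral_const, smul_eq_mul]

/-! ### Positive semidefinite matrices -/

section PosSemidef

variable {ι : Type*} [Fintype ι]

lemma l2_sq (x : ι → ℂ) : l2 x ^ 2 = ∑ i, ‖x i‖ ^ 2 := by
  rw [l2, EuclideanSpace.norm_sq_eq]

lemma star_dotProduct_self (x : ι → ℂ) : star x ⬝ᵥ x = ((l2 x ^ 2 : ℝ) : ℂ) := by
  rw [dotProduct_comm, ← EuclideanSpace.inner_toLp_toLp, inner_self_eq_norm_sq_to_K, l2]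
  norm_cast

lemma l2_pos {x : ι → ℂ} (hx : x ≠ 0) : 0 < l2 x := by
  simpa [l2] using hx

lemma norm_star_dotProduct_le (x y : ι → ℂ) : ‖star x ⬝ᵥ y‖ ≤ l2 x * l2 y := by
  rw [dotProduct_comm, ← EuclideanSpace.inner_toLp_toLp]
  exact norm_inner_le_norm _ _

lemma norm_star_dotProduct_sq_le (x y : ι → ℂ) : ‖star x ⬝ᵥ y‖ ^ 2 ≤ l2 x ^ 2 * l2 y ^ 2 := by
  rw [← mul_pow]
  exact pow_le_pow_left₀ (norm_nonneg _) (norm_star_dotProduct_le x y) 2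

lemma norm_star_dotProduct_comm (x y : ι → ℂ) : ‖star x ⬝ᵥ y‖ = ‖star y ⬝ᵥ x‖ := by
  rw [star_dotProduct, norm_star]

lemma re_dotProduct_vecMulVec_mulVec (w x : ι → ℂ) :
    (star x ⬝ᵥ (vecMulVec w (star w) *ᵥ x)).re = ‖star w ⬝ᵥ x‖ ^ 2 := by
  rw [vecMulVec_mulVec, op_smul_eq_smul, dotProduct_smul, smul_eq_mul, star_dotProduct x w,
    Complex.star_def, Complex.mul_conj']
  norm_cast

lemma trace_vecMulVec_star (w : ι → ℂ) : (vecMulVec w (star w)).trace.re = l2 w ^ 2 := by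
  rw [trace_vecMulVec, dotProduct_comm, star_dotProduct_self, Complex.ofReal_re]

lemma isClosed_posSemidef {n : Type*} [Finite n] : IsClosed {X : Matrix n n ℂ | X.PosSemidef} := by
  have := Fintype.ofFinite n
  simp only [posSemidef_iff_dotProduct_mulVec, Set.ofPred_and, Set.ofPred_forall]
  exact (isClosed_eq (by fun_prop) continuous_id).inter
    (isClosed_iInter fun x => isClosed_le continuous_const (by fun_prop))

lemma exists_mulVec_ne_zero_dotProduct_eq_zero {m n K : Type*} [Fintype m] [Fintype n] [Field K]
    {X : Matrix m n K} (hX : 2 ≤ X.rank) (b : m → K) :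
    ∃ z, X *ᵥ z ≠ 0 ∧ b ⬝ᵥ (X *ᵥ z) = 0 := by
  let φ : LinearMap.range X.mulVecLin →ₗ[K] K :=
    dotProductBilin K K b ∘ₗ (LinearMap.range X.mulVecLin).subtype
  have hker : LinearMap.ker φ ≠ ⊥ := by
    apply LinearMap.ker_ne_bot_of_finrank_lt
    rw [Module.finrank_self]
    exact hX
  obtain ⟨⟨x, z, rfl⟩, hx, hx0⟩ := Submodule.exists_mem_ne_zero_of_ne_bot hker
  exact ⟨z, fun h => hx0 (Subtype.ext h), hx⟩

lemma exists_mulVec_ne_zero {m n K : Type*} [Fintype n] [Field K] {X : Matrix m n K}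
    (hX : X ≠ 0) : ∃ z, X *ᵥ z ≠ 0 := by
  contrapose! hX
  exact mulVec_injective (funext fun z => by rw [hX z, zero_mulVec])

variable {X : Matrix ι ι ℂ} (hX : X.PosSemidef)
include hX

lemma norm_dotProduct_mulVec_sq_le (y z : ι → ℂ) :
    ‖star y ⬝ᵥ (X *ᵥ z)‖ ^ 2 ≤ (star y ⬝ᵥ (X *ᵥ y)).re * (star z ⬝ᵥ (X *ᵥ z)).re := by
  classical
  obtain ⟨R, rfl⟩ : ∃ R : Matrix ι ι ℂ, X = Rᴴ * R := by
    open scoped MatrixOrder in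
    exact CStarAlgebra.nonneg_iff_eq_star_mul_self.1 hX.nonneg
  have hR (y z : ι → ℂ) : star y ⬝ᵥ ((Rᴴ * R) *ᵥ z) = star (R *ᵥ y) ⬝ᵥ (R *ᵥ z) := by
    rw [← mulVec_mulVec, dotProduct_mulVec, star_mulVec]
  simp only [hR, star_dotProduct_self, Complex.ofReal_re]
  exact norm_star_dotProduct_sq_le _ _

lemma re_dotProduct_mulVec_pos {z : ι → ℂ} (hz : X *ᵥ z ≠ 0) : 0 < (star z ⬝ᵥ (X *ᵥ z)).re := by
  classical
  refine (hX.re_dotProduct_nonneg z).lt_of_ne fun h => hz ?_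
  rw [← hX.dotProduct_mulVec_zero_iff]
  exact Complex.ext h.symm (hX.isHermitian.im_star_dotProduct_mulVec_self z)

lemma posSemidef_sub_smul_vecMulVec (z : ι → ℂ) :
    (X - (star z ⬝ᵥ (X *ᵥ z)).re⁻¹ • vecMulVec (X *ᵥ z) (star (X *ᵥ z))).PosSemidef := by
  set q := (star z ⬝ᵥ (X *ᵥ z)).re
  have hherm : (X - q⁻¹ • vecMulVec (X *ᵥ z) (star (X *ᵥ z))).IsHermitian :=
    hX.isHermitian.sub (by simp [IsHermitian, conjTranspose_smul, conjTranspose_vecMulVec])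
  refine PosSemidef.of_dotProduct_mulVec_nonneg hherm fun y => Complex.nonneg_iff.2
    ⟨?_, (hherm.im_star_dotProduct_mulVec_self y).symm⟩
  rw [sub_mulVec, smul_mulVec, dotProduct_sub, dotProduct_smul, Complex.sub_re, Complex.smul_re,
    re_dotProduct_vecMulVec_mulVec, norm_star_dotProduct_comm, smul_eq_mul, sub_nonneg]
  refine inv_mul_le_of_le_mul₀ (hX.re_dotProduct_nonneg z) (hX.re_dotProduct_nonneg y) ?_
  rw [mul_comm]
  exact norm_dotProduct_mulVec_sq_le hX y z

lemma eq_smul_vecMulVec_of_rank_eq_one (hr : X.rank = 1) {z : ι → ℂ} (hz : X *ᵥ z ≠ 0) :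
    X = (star z ⬝ᵥ (X *ᵥ z)).re⁻¹ • vecMulVec (X *ᵥ z) (star (X *ᵥ z)) := by
  have hq := re_dotProduct_mulVec_pos hX hz
  have hqz : star z ⬝ᵥ (X *ᵥ z) = ((star z ⬝ᵥ (X *ᵥ z)).re : ℂ) :=
    Complex.ext rfl (hX.isHermitian.im_star_dotProduct_mulVec_self z)
  refine mulVec_injective (funext fun y => ?_)
  obtain ⟨c, hc⟩ : ∃ c : ℂ, c • X *ᵥ z = X *ᵥ y := by
    obtain ⟨c, hc⟩ := (finrank_eq_one_iff_of_nonzero'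
      (⟨X *ᵥ z, z, rfl⟩ : LinearMap.range X.mulVecLin) (by simpa [Subtype.ext_iff] using hz)).1 hr
      ⟨X *ᵥ y, y, rfl⟩
    exact ⟨c, congrArg Subtype.val hc⟩
  have hy : star (X *ᵥ z) ⬝ᵥ y = c * (star z ⬝ᵥ (X *ᵥ z)).re := by
    rw [star_mulVec, hX.isHermitian.eq, ← dotProduct_mulVec, ← hc, dotProduct_smul, smul_eq_mul,
      ← hqz]
  rw [smul_mulVec, vecMulVec_mulVec, hy, op_smul_eq_smul, mul_comm c, mul_smul, Complex.coe_smul,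
    inv_smul_smul₀ hq.ne', hc]

lemma exists_vecMulVec_eq_of_rank_eq_one (hr : X.rank = 1) :
    ∃ w : ι → ℂ, vecMulVec w (star w) = X := by
  obtain ⟨z, hz⟩ := exists_mulVec_ne_zero (X := X) (by rintro rfl; simp at hr)
  set q := (star z ⬝ᵥ (X *ᵥ z)).re
  have hq : 0 < q := re_dotProduct_mulVec_pos hX hz
  refine ⟨(√q)⁻¹ • (X *ᵥ z), ?_⟩
  rw [star_smul, star_trivial, vecMulVec_smul, smul_vecMulVec, smul_smul, ← mul_inv,
    Real.mul_self_sqrt hq.le]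
  exact (eq_smul_vecMulVec_of_rank_eq_one hX hr hz).symm

lemma trace_re_nonneg : 0 ≤ X.trace.re := (Complex.le_def.1 hX.trace_nonneg).1

lemma norm_apply_le_trace_re (i j : ι) : ‖X i j‖ ≤ X.trace.re := by
  classical
  have hdiag_nonneg (k : ι) : 0 ≤ (X k k).re := (Complex.le_def.1 (hX.diag_nonneg (i := k))).1
  have hdiag_le (k : ι) : (X k k).re ≤ X.trace.re := by
    rw [trace, Complex.re_sum]
    exact Finset.single_le_sum (f := fun k => (X k k).re) (fun k _ => hdiag_nonneg k)
      (Finset.mem_univ k)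
  have hij : ‖X i j‖ ^ 2 ≤ (X i i).re * (X j j).re := by
    simpa using norm_dotProduct_mulVec_sq_le hX (Pi.single i 1) (Pi.single j 1)
  refine (pow_le_pow_iff_left₀ (norm_nonneg _) (trace_re_nonneg hX) two_ne_zero).1 (hij.trans ?_)
  rw [sq]
  exact mul_le_mul (hdiag_le i) (hdiag_le j) (hdiag_nonneg j) (trace_re_nonneg hX)

end PosSemidef

/-! ### The semidefinite relaxation as a conic program -/

lemma quad_nonneg {X : Matrix (Fin N) (Fin N) ℂ} (hX : X.PosSemidef) (h : Fin N → ℂ) :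
    0 ≤ quad X h := hX.re_dotProduct_nonneg h

lemma quad_vecMulVec (w h : Fin N → ℂ) : quad (vecMulVec w (star w)) h = ‖star w ⬝ᵥ h‖ ^ 2 :=
  re_dotProduct_vecMulVec_mulVec w h

/-- `X ↦ hᴴ X h`, as a function of `h ∈ K`. -/
def quadOn (K : Set (Fin N → ℂ)) : Matrix (Fin N) (Fin N) ℂ →ₗ[ℝ] C(K, ℝ) where
  toFun X := ⟨fun h => quad X h, by unfold quad; fun_prop⟩
  map_add' X Y := by ext h; simp [quad, add_mulVec, dotProduct_add]
  map_smul' c X := by ext h; simp [quad, smul_mulVec, dotProduct_smul]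

lemma quadOn_apply (K : Set (Fin N → ℂ)) (X : Matrix (Fin N) (Fin N) ℂ) (h : K) :
    quadOn K X h = quad X h := rfl

/-- The trace of a Hermitian matrix as a real-linear functional; the real part makes it
real-valued on all matrices. -/
def traceRe (N : ℕ) : Matrix (Fin N) (Fin N) ℂ →ₗ[ℝ] ℝ :=
  Complex.reLm ∘ₗ traceLinearMap (Fin N) ℝ ℂ

lemma traceRe_apply (X : Matrix (Fin N) (Fin N) ℂ) : traceRe N X = X.trace.re := rfl

/-- The cone of admissible transmit covariances of a single user. -/
def psdCone (B : Finset (Fin N)) : PointedCone ℝ (Matrix (Fin N) (Fin N) ℂ) where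
  carrier := {Z | Z.PosSemidef ∧ ∀ n ∈ B, Z n = 0}
  zero_mem' := ⟨.zero, fun _ _ => rfl⟩
  add_mem' hY hZ := ⟨hY.1.add hZ.1, fun n hn => by
    ext k
    simp [hY.2 n hn, hZ.2 n hn]⟩
  smul_mem' := by
    rintro ⟨c, hc⟩ Z ⟨hZ, hB⟩
    refine ⟨hZ.smul hc, fun n hn => ?_⟩
    change c • Z n = 0
    rw [hB n hn, smul_zero]

lemma vecMulVec_mem_psdCone {B : Finset (Fin N)} {u : Fin N → ℂ} (hu : ∀ n ∈ B, u n = 0) :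
    vecMulVec u (star u) ∈ psdCone B :=
  ⟨posSemidef_vecMulVec_self_star u, fun n hn => by ext k; simp [vecMulVec_apply, hu n hn]⟩

/-- The cone of admissible transmit covariances of all users. -/
def covCone (M : ℕ) (B : Finset (Fin N)) :
    PointedCone ℝ (Fin M → Matrix (Fin N) (Fin N) ℂ) :=
  Submodule.pi Set.univ fun _ => psdCone B

lemma mem_covCone_iff {B : Finset (Fin N)} {X : Fin M → Matrix (Fin N) (Fin N) ℂ} :
    X ∈ covCone M B ↔ ∀ m, X m ∈ psdCone B := by
  simp [covCone, Submodule.mem_pi]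

lemma single_mem_covCone {B : Finset (Fin N)} {Z : Matrix (Fin N) (Fin N) ℂ} (hZ : Z ∈ psdCone B)
    (m : Fin M) : Pi.single m Z ∈ covCone M B :=
  mem_covCone_iff.2 fun j => by
    rcases eq_or_ne j m with rfl | hj
    · rwa [Pi.single_eq_same]
    · rw [Pi.single_eq_of_ne hj]
      exact zero_mem _

/-- The objective of the semidefinite relaxation as a linear map. -/
def sdrPowerLin (N M : ℕ) : (Fin M → Matrix (Fin N) (Fin N) ℂ) →ₗ[ℝ] ℝ :=
  ∑ m, traceRe N ∘ₗ LinearMap.proj m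

lemma sdrPowerLin_apply (X : Fin M → Matrix (Fin N) (Fin N) ℂ) :
    sdrPowerLin N M X = sdrPower X := by
  simp [sdrPowerLin, sdrPower, traceRe_apply]

/-- Useful signal minus `γ m` times interference of user `m`, as a function of its channel: the
left-hand side of the worst-case SINR constraints once the fraction is cleared. -/
def sinrMargin (D : Scenario N M) :
    (Fin M → Matrix (Fin N) (Fin N) ℂ) →ₗ[ℝ] ∀ m, C(uncertainty D m, ℝ) :=
  LinearMap.pi fun m => quadOn _ ∘ₗ LinearMap.proj m -
    D.γ m • ∑ j ∈ Finset.univ.erase m, quadOn _ ∘ₗ LinearMap.proj j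

/-- The lower bound on `sinrMargin` in the worst-case SINR constraints. -/
def noiseMargin (D : Scenario N M) (m : Fin M) : C(uncertainty D m, ℝ) :=
  .const _ (D.γ m * D.σ m ^ 2)

lemma sinrMargin_apply (D : Scenario N M) (X : Fin M → Matrix (Fin N) (Fin N) ℂ) (m : Fin M)
    (h : uncertainty D m) :
    sinrMargin D X m h = quad (X m) h - D.γ m * ∑ j ∈ Finset.univ.erase m, quad (X j) h := by
  simp [sinrMargin, quadOn_apply]

lemma le_iInf_div_iff {ι : Type*} [Nonempty ι] {f g : ι → ℝ} (hf : ∀ i, 0 ≤ f i)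
    (hg : ∀ i, 0 < g i) {c : ℝ} : c ≤ ⨅ i, f i / g i ↔ ∀ i, c * g i ≤ f i := by
  have hbdd : BddBelow (Set.range fun i => f i / g i) :=
    ⟨0, Set.forall_mem_range.2 fun i => div_nonneg (hf i) (hg i).le⟩
  simp only [le_ciInf_iff hbdd, le_div_iff₀ (hg _)]

lemma col_mem_uncertainty (D : Scenario N M) {m : Fin M} (hε : 0 ≤ D.ε m) :
    D.H.col m ∈ uncertainty D m :=
  ⟨0, by simpa [l2] using hε, by simp⟩

section

variable (D : Scenario N M) (hε : ∀ m, 0 < D.ε m) (hσ : ∀ m, 0 < D.σ m) (B : Finset (Fin N))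
include hε hσ

lemma mem_sdrFeasible_iff (X : Fin M → Matrix (Fin N) (Fin N) ℂ) :
    X ∈ sdrFeasible D B ↔ X ∈ covCone M B ∧ noiseMargin D ≤ sinrMargin D X := by
  have hqos (hX : ∀ m, (X m).PosSemidef) (m : Fin M) :
      D.γ m ≤ sdrQos D X m ↔ noiseMargin D m ≤ sinrMargin D X m := by
    have : Nonempty (uncertainty D m) := ⟨⟨_, col_mem_uncertainty D (hε m).le⟩⟩
    rw [sdrQos, le_iInf_div_iff (f := fun h : uncertainty D m => quad (X m) h)
      (fun h => quad_nonneg (hX m) h) fun h => add_pos_of_nonneg_of_pos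
        (Finset.sum_nonneg fun j _ => quad_nonneg (hX j) h) (pow_pos (hσ m) 2)]
    rw [ContinuousMap.le_def]
    refine forall_congr' fun h => ?_
    rw [sinrMargin_apply, noiseMargin, ContinuousMap.const_apply, le_sub_iff_add_le', mul_add]
  rw [mem_covCone_iff]
  constructor
  · rintro ⟨hX, hX', hB⟩
    exact ⟨fun m => ⟨hX m, hB m⟩, fun m => (hqos hX m).1 (hX' m)⟩
  · rintro ⟨hX, hX'⟩
    exact ⟨fun m => (hX m).1, fun m => (hqos (fun j => (hX j).1) m).2 (hX' m), fun m => (hX m).2⟩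

end

/-! ### Attainment -/

lemma continuous_sdrPower : Continuous (sdrPower (N := N) (M := M)) := by
  unfold sdrPower
  fun_prop

lemma isClosed_psdCone (B : Finset (Fin N)) :
    IsClosed (psdCone B : Set (Matrix (Fin N) (Fin N) ℂ)) := by
  have hrow : IsClosed {Z : Matrix (Fin N) (Fin N) ℂ | ∀ n ∈ B, Z n = 0} := by
    simp only [Set.ofPred_forall]
    exact isClosed_biInter fun n _ => isClosed_eq
      (continuous_pi fun k => continuous_id.matrix_elem n k) continuous_const
  exact isClosed_posSemidef.inter hrow

lemma isClosed_sinrMargin_ge (D : Scenario N M) :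
    IsClosed {X : Fin M → Matrix (Fin N) (Fin N) ℂ | noiseMargin D ≤ sinrMargin D X} := by
  simp only [Pi.le_def, ContinuousMap.le_def, sinrMargin_apply, Set.ofPred_forall]
  refine isClosed_iInter fun m => isClosed_iInter fun h => isClosed_le continuous_const ?_
  unfold quad
  fun_prop

lemma isClosed_sdrFeasible (D : Scenario N M) (hε : ∀ m, 0 < D.ε m) (hσ : ∀ m, 0 < D.σ m)
    (B : Finset (Fin N)) : IsClosed (sdrFeasible D B) := by
  have hcone : IsClosed {X : Fin M → Matrix (Fin N) (Fin N) ℂ | X ∈ covCone M B} := by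
    simp only [mem_covCone_iff, Set.ofPred_forall]
    exact isClosed_iInter fun m => (isClosed_psdCone B).preimage (continuous_apply m)
  have hset : sdrFeasible D B = {X | X ∈ covCone M B} ∩ {X | noiseMargin D ≤ sinrMargin D X} :=
    Set.ext (mem_sdrFeasible_iff D hε hσ B)
  exact hset ▸ hcone.inter (isClosed_sinrMargin_ge D)

lemma norm_apply_le_sdrPower {X : Fin M → Matrix (Fin N) (Fin N) ℂ} (hX : ∀ m, (X m).PosSemidef)
    (m : Fin M) (i j : Fin N) : ‖X m i j‖ ≤ sdrPower X :=
  (norm_apply_le_trace_re (hX m) i j).trans <|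
    Finset.single_le_sum (f := fun m => (X m).trace.re) (fun m _ => trace_re_nonneg (hX m))
      (Finset.mem_univ m)

lemma exists_isOptimal_sdr (D : Scenario N M) (hε : ∀ m, 0 < D.ε m) (hσ : ∀ m, 0 < D.σ m)
    {B : Finset (Fin N)} (hne : (sdrFeasible D B).Nonempty) :
    ∃ X, IsOptimal sdrPower (sdrFeasible D B) X := by
  obtain ⟨X₀, hX₀⟩ := hne
  have hbox : IsCompact (Set.univ.pi fun _ : Fin M => Set.univ.pi fun _ : Fin N =>
      Set.univ.pi fun _ : Fin N => Metric.closedBall (0 : ℂ) (sdrPower X₀)) :=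
    isCompact_univ_pi fun _ => isCompact_univ_pi fun _ => isCompact_univ_pi fun _ =>
      isCompact_closedBall _ _
  refine exists_isOptimal_of_isCompact continuous_sdrPower.continuousOn hX₀
    (hbox.of_isClosed_subset ((isClosed_sdrFeasible D hε hσ B).inter
      (isClosed_le continuous_sdrPower continuous_const)) ?_)
  rintro X ⟨hX, hle⟩ m - i - j -
  exact mem_closedBall_zero_iff.2 ((norm_apply_le_sdrPower hX.1 m i j).trans hle)

/-! ### Rank-one covariances -/

lemma quad_outer (W : Matrix (Fin N) (Fin M) ℂ) (m : Fin M) (h : Fin N → ℂ) :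
    quad (outer W m) h = ‖gain W m h‖ ^ 2 := quad_vecMulVec _ _

lemma sdrPower_outer (W : Matrix (Fin N) (Fin M) ℂ) : sdrPower (outer W) = power W := by
  simp only [sdrPower, outer, trace_vecMulVec_star, l2_sq, power]
  exact Finset.sum_comm

lemma outer_apply_eq_zero_iff (W : Matrix (Fin N) (Fin M) ℂ) (n : Fin N) :
    (∀ m, outer W m n = 0) ↔ W n = 0 := by
  constructor
  · intro h
    funext m
    simpa [outer, vecMulVec_apply] using congrFun (h m) n
  · intro h m
    funext k
    simp [outer, vecMulVec_apply, h]

lemma outer_mem_sdrFeasible_iff (D : Scenario N M) (B : Finset (Fin N))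
    (W : Matrix (Fin N) (Fin M) ℂ) : outer W ∈ sdrFeasible D B ↔ W ∈ relaxFeasible D .RBF B := by
  have hqos (m : Fin M) : sdrQos D (outer W) m = qos D .RBF W m := by
    simp only [sdrQos, qos, sinr, quad_outer]
  simp only [sdrFeasible, relaxFeasible, Set.mem_ofPred_eq, hqos, ← outer_apply_eq_zero_iff W]
  refine ⟨fun h => ⟨h.2.1, fun n hn m => h.2.2 m n hn⟩, fun h =>
    ⟨fun m => posSemidef_vecMulVec_self_star _, h.1, fun m n hn => h.2 n hn m⟩⟩

lemma solvedBySDR_of_rank (D : Scenario N M) (hε : ∀ m, 0 < D.ε m) (hσ : ∀ m, 0 < D.σ m)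
    (B : Finset (Fin N))
    (hrank : ∀ X, IsOptimal sdrPower (sdrFeasible D B) X → ∀ m, (X m).rank = 1) :
    SolvedBySDR D B := by
  have hfac : ∀ X, IsOptimal sdrPower (sdrFeasible D B) X → ∃ W, outer W = X := by
    intro X hX
    choose w hw using fun m => exists_vecMulVec_eq_of_rank_eq_one (hX.1.1 m) (hrank X hX m)
    exact ⟨Matrix.of fun n m => w m n, funext hw⟩
  refine ⟨le_antisymm ?_ ?_, ?_, fun X hX => ⟨hrank X hX, hfac X hX, ?_⟩⟩
  · refine optValue_le_optValue fun Y hY => ?_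
    obtain ⟨X, hX⟩ := exists_isOptimal_sdr D hε hσ ⟨Y, hY⟩
    obtain ⟨W, rfl⟩ := hfac X hX
    exact ⟨W, (outer_mem_sdrFeasible_iff D B W).1 hX.1,
      (sdrPower_outer W).symm.le.trans (hX.2 hY)⟩
  · exact optValue_le_optValue fun W hW =>
      ⟨outer W, (outer_mem_sdrFeasible_iff D B W).2 hW, (sdrPower_outer W).le⟩
  · rintro ⟨W, hW⟩
    exact exists_isOptimal_sdr D hε hσ ⟨_, (outer_mem_sdrFeasible_iff D B W).2 hW⟩
  · rintro W rfl
    refine ⟨(outer_mem_sdrFeasible_iff D B W).1 hX.1, fun V hV => ?_⟩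
    simpa only [Set.mem_ofPred_eq, sdrPower_outer] using
      hX.2 ((outer_mem_sdrFeasible_iff D B V).2 hV)

/-! ### Dual measures -/

section DualMeasures

variable {D : Scenario N M} {B : Finset (Fin N)}

instance (D : Scenario N M) (m : Fin M) : CompactSpace (uncertainty D m) := by
  have himage : uncertainty D m = (fun e : EuclideanSpace ℂ (Fin N) => D.H.col m + e.ofLp) ''
      Metric.closedBall 0 (D.ε m) := by
    ext h
    constructor
    · rintro ⟨e, he, rfl⟩
      exact ⟨WithLp.toLp 2 e, mem_closedBall_zero_iff.2 he, rfl⟩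
    · rintro ⟨e, he, rfl⟩
      exact ⟨e.ofLp, mem_closedBall_zero_iff.1 he, rfl⟩
  rw [← isCompact_iff_compactSpace, himage]
  exact (isCompact_closedBall _ _).image (by fun_prop)

/-- `X ↦ ∫ hᴴ X h dμ(h)`, the pairing of a covariance with a dual measure. -/
def quadIntegral {K : Set (Fin N → ℂ)} [CompactSpace K] (μ : FiniteMeasure K) :
    Matrix (Fin N) (Fin N) ℂ →ₗ[ℝ] ℝ where
  toFun X := ∫ h, quadOn K X h ∂μ
  map_add' X Y := by
    simp only [map_add, ContinuousMap.add_apply]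
    exact integral_add (integrable_of_continuous (map_continuous _) _)
      (integrable_of_continuous (map_continuous _) _)
  map_smul' c X := by
    simp only [map_smul, ContinuousMap.smul_apply]
    exact integral_smul c _

lemma quadIntegral_apply {K : Set (Fin N → ℂ)} [CompactSpace K] (μ : FiniteMeasure K)
    (X : Matrix (Fin N) (Fin N) ℂ) : quadIntegral μ X = ∫ h : K, quad X h ∂μ := rfl

/-- The slack of user `m` in the dual of the semidefinite relaxation, whose variables are measures
on the uncertainty sets: the coefficient of `X m` in the Lagrangian. -/
def dualSlack (D : Scenario N M) (μ : ∀ m, FiniteMeasure (uncertainty D m)) (m : Fin M) :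
    Matrix (Fin N) (Fin N) ℂ →ₗ[ℝ] ℝ :=
  traceRe N - quadIntegral (μ m) + ∑ j ∈ Finset.univ.erase m, D.γ j • quadIntegral (μ j)

lemma dualSlack_apply (μ : ∀ m, FiniteMeasure (uncertainty D m)) (m : Fin M)
    (Z : Matrix (Fin N) (Fin N) ℂ) :
    dualSlack D μ m Z = Z.trace.re - quadIntegral (μ m) Z +
      ∑ j ∈ Finset.univ.erase m, D.γ j * quadIntegral (μ j) Z := by
  simp [dualSlack, traceRe_apply]

lemma integral_sinrMargin (μ : ∀ m, FiniteMeasure (uncertainty D m))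
    (X : Fin M → Matrix (Fin N) (Fin N) ℂ) (m : Fin M) :
    ∫ h, sinrMargin D X m h ∂μ m =
      quadIntegral (μ m) (X m) - D.γ m * ∑ j ∈ Finset.univ.erase m, quadIntegral (μ m) (X j) := by
  have hint (j : Fin M) : Integrable (fun h : uncertainty D m => quad (X j) h) (μ m) :=
    integrable_of_continuous (map_continuous (quadOn _ (X j))) _
  simp only [sinrMargin_apply, quadIntegral_apply]
  rw [integral_sub (hint m) ((integrable_finsetSum _ fun j _ => hint j).const_mul _),
    integral_const_mul, integral_finsetSum _ fun j _ => hint j]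

lemma sum_dualSlack (μ : ∀ m, FiniteMeasure (uncertainty D m))
    (X : Fin M → Matrix (Fin N) (Fin N) ℂ) :
    ∑ m, dualSlack D μ m (X m) = sdrPower X - ∑ m, ∫ h, sinrMargin D X m h ∂μ m := by
  have hcomm : ∑ m, ∑ j ∈ Finset.univ.erase m, D.γ j * quadIntegral (μ j) (X m) =
      ∑ m, D.γ m * ∑ j ∈ Finset.univ.erase m, quadIntegral (μ m) (X j) := by
    simp only [Finset.mul_sum]
    exact Finset.sum_comm' (by simp [eq_comm])
  simp only [dualSlack_apply, integral_sinrMargin, Finset.sum_add_distrib, Finset.sum_sub_distrib,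
    hcomm, sdrPower]
  ring

/-- Measures on the uncertainty sets that certify the optimality of `X` in the semidefinite
relaxation: they are dual feasible and satisfy complementary slackness. -/
structure IsDualCertificate (D : Scenario N M) (B : Finset (Fin N))
    (X : Fin M → Matrix (Fin N) (Fin N) ℂ) (μ : ∀ m, FiniteMeasure (uncertainty D m)) : Prop where
  nonneg : ∀ m, ∀ Z ∈ psdCone B, 0 ≤ dualSlack D μ m Z
  complementary : ∀ m, dualSlack D μ m (X m) = 0

lemma le_norm_smul_one {ι : Type*} [Fintype ι] {K : ι → Type*} [∀ i, TopologicalSpace (K i)]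
    [∀ i, CompactSpace (K i)] (f : ∀ i, C(K i, ℝ)) : f ≤ ‖f‖ • 1 := by
  intro i h
  simpa using (le_abs_self _).trans (((f i).norm_coe_le_norm h).trans (norm_le_pi_norm f i))

lemma exists_measures_of_multiplier {y : (∀ m, C(uncertainty D m, ℝ)) →ₗ[ℝ] ℝ}
    (hy : ∀ w, 0 ≤ w → 0 ≤ y w) :
    ∃ μ : ∀ m, FiniteMeasure (uncertainty D m), ∀ w, y w = ∑ m, ∫ h, w m h ∂μ m := by
  choose μ hμ using fun m => exists_finiteMeasure_integral_eq
    (Λ := y ∘ₗ LinearMap.single ℝ (fun m => C(uncertainty D m, ℝ)) m) fun f hf =>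
      hy _ (Pi.single_nonneg.2 hf)
  refine ⟨μ, fun w => ?_⟩
  simp only [hμ, LinearMap.comp_apply, LinearMap.single_apply]
  rw [← map_sum, Finset.univ_sum_single]

theorem exists_isDualCertificate (hε : ∀ m, 0 < D.ε m) (hσ : ∀ m, 0 < D.σ m)
    {X X₀ : Fin M → Matrix (Fin N) (Fin N) ℂ} (hX : IsOptimal sdrPower (sdrFeasible D B) X)
    (hX₀ : X₀ ∈ covCone M B) (hslater : noiseMargin D + 1 ≤ sinrMargin D X₀) :
    ∃ μ, IsDualCertificate D B X μ := by
  obtain ⟨hXcone, hXmargin⟩ := (mem_sdrFeasible_iff D hε hσ B X).1 hX.1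
  have hmin : ∀ Z ∈ covCone M B, noiseMargin D ≤ sinrMargin D Z →
      sdrPowerLin N M X ≤ sdrPowerLin N M Z := fun Z hZ hZ' => by
    simpa only [sdrPowerLin_apply, Set.mem_ofPred_eq] using
      hX.2 ((mem_sdrFeasible_iff D hε hσ B Z).2 ⟨hZ, hZ'⟩)
  obtain ⟨y, hy, hle, heq⟩ := exists_lagrange_multiplier hXcone hXmargin hmin hX₀ fun w =>
    ⟨‖w‖, norm_nonneg w, (le_norm_smul_one w).trans
      (smul_le_smul_of_nonneg_left (le_sub_iff_add_le'.2 hslater) (norm_nonneg w))⟩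
  obtain ⟨μ, hμ⟩ := exists_measures_of_multiplier hy
  simp only [hμ, sdrPowerLin_apply] at hle heq
  have hnonneg (m : Fin M) (Z) (hZ : Z ∈ psdCone B) : 0 ≤ dualSlack D μ m Z := by
    have hsum := sum_dualSlack μ (Pi.single m Z)
    rw [Finset.sum_eq_single m (fun j _ hj => by rw [Pi.single_eq_of_ne hj, map_zero])
      (by simp), Pi.single_eq_same] at hsum
    exact hsum ▸ sub_nonneg.2 (hle _ (single_mem_covCone hZ m))
  have hzero : ∑ m, dualSlack D μ m (X m) = 0 := by
    rw [sum_dualSlack, heq, sub_self]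
  refine ⟨μ, hnonneg, fun m => ?_⟩
  exact (Finset.sum_eq_zero_iff_of_nonneg fun m _ =>
    hnonneg m _ (mem_covCone_iff.1 hXcone m)).1 hzero m (Finset.mem_univ m)

end DualMeasures

/-! ### Mean and variance of a channel distribution -/

section Mean

variable {K : Set (Fin N → ℂ)}

/-- The mean of the (not normalized) channel distribution `μ`, which is `0` if `μ = 0`. -/
def channelMean (μ : FiniteMeasure K) : Fin N → ℂ :=
  (⨍ h : K, WithLp.toLp 2 h.1 ∂μ).ofLp

/-- The second central moment of the channel distribution `μ`, not normalized by its mass. -/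
def channelVar (μ : FiniteMeasure K) : ℝ :=
  ∫ h : K, l2 (h.1 - channelMean μ) ^ 2 ∂μ

lemma integral_finiteMeasure_const {X : Type*} [MeasurableSpace X] (μ : FiniteMeasure X) (c : ℝ) :
    ∫ _, c ∂(μ : Measure X) = μ.mass * c := integral_const c

lemma channelVar_nonneg (μ : FiniteMeasure K) : 0 ≤ channelVar μ :=
  integral_nonneg fun _ => sq_nonneg _

lemma continuous_l2 : Continuous (l2 : (Fin N → ℂ) → ℝ) := by
  unfold l2
  fun_prop

variable [CompactSpace K]

lemma integral_l2_sub_sq (μ : FiniteMeasure K) (a : Fin N → ℂ) :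
    ∫ h : K, l2 (h.1 - a) ^ 2 ∂μ =
      channelVar μ + μ.mass * l2 (channelMean μ - a) ^ 2 := by
  have hmem : MemLp (fun h : K => WithLp.toLp 2 h.1) 2 (μ : Measure K) :=
    Continuous.memLp_of_hasCompactSupport (by fun_prop) (HasCompactSupport.of_compactSpace _)
  exact integral_norm_sub_sq hmem (WithLp.toLp 2 a)

lemma average_star_dotProduct (μ : FiniteMeasure K) (x : Fin N → ℂ) :
    ⨍ h : K, star x ⬝ᵥ h.1 ∂μ = star x ⬝ᵥ channelMean μ := by
  have hint : Integrable (fun h : K => WithLp.toLp 2 h.1) (μ : Measure K) :=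
    integrable_of_continuous (by fun_prop) _
  have hinner := integral_inner (𝕜 := ℂ) hint.to_average (WithLp.toLp 2 x)
  simp only [EuclideanSpace.inner_toLp_toLp, dotProduct_comm _ (star x)] at hinner
  rw [channelMean, average, average, hinner, EuclideanSpace.inner_eq_star_dotProduct,
    dotProduct_comm]

lemma mul_norm_dotProduct_channelMean_sq_le (μ : FiniteMeasure K) (x : Fin N → ℂ) :
    μ.mass * ‖star x ⬝ᵥ channelMean μ‖ ^ 2 ≤
      quadIntegral μ (vecMulVec x (star x)) := by
  have hmem : MemLp (fun h : K => star x ⬝ᵥ h.1) 2 (μ : Measure K) :=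
    Continuous.memLp_of_hasCompactSupport (by fun_prop) (HasCompactSupport.of_compactSpace _)
  have hvar := integral_norm_sub_sq hmem 0
  simp only [sub_zero, average_star_dotProduct] at hvar
  simp only [quadIntegral_apply, quad_vecMulVec, hvar]
  exact le_add_of_nonneg_left (integral_nonneg fun _ => sq_nonneg _)

lemma quadIntegral_vecMulVec_le_mul_channelVar (μ : FiniteMeasure K) {x : Fin N → ℂ}
    (hx : star x ⬝ᵥ channelMean μ = 0) :
    quadIntegral μ (vecMulVec x (star x)) ≤ l2 x ^ 2 * channelVar μ := by
  rw [quadIntegral_apply, channelVar, ← integral_const_mul]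
  refine integral_mono (integrable_of_continuous (map_continuous (quadOn K _)) _)
    (integrable_of_continuous ?_ _) fun h => ?_
  · exact ((continuous_l2.comp (by fun_prop)).pow 2).const_mul _
  · have hsub : star x ⬝ᵥ h.1 = star x ⬝ᵥ (h.1 - channelMean μ) := by
      rw [dotProduct_sub, hx, sub_zero]
    simpa only [quad_vecMulVec, hsub] using norm_star_dotProduct_sq_le x (h.1 - channelMean μ)

lemma quadIntegral_vecMulVec_le (μ : FiniteMeasure K) {x : Fin N → ℂ} {C : ℝ}
    (hC : ∀ h ∈ K, ‖star x ⬝ᵥ h‖ ^ 2 ≤ C) :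
    quadIntegral μ (vecMulVec x (star x)) ≤ C * μ.mass := by
  rw [quadIntegral_apply, mul_comm, ← integral_finiteMeasure_const]
  exact integral_mono (integrable_of_continuous (map_continuous (quadOn K _)) _)
    (integrable_const C) fun h => (quad_vecMulVec x h).trans_le (hC h h.2)

end Mean

lemma quadIntegral_nonneg {K : Set (Fin N → ℂ)} [CompactSpace K] (μ : FiniteMeasure K)
    {X : Matrix (Fin N) (Fin N) ℂ} (hX : X.PosSemidef) : 0 ≤ quadIntegral μ X :=
  integral_nonneg fun h => quad_nonneg hX h

lemma l2_sub_col_sq_le {D : Scenario N M} {m : Fin M} {h : Fin N → ℂ}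
    (hh : h ∈ uncertainty D m) : l2 (h - D.H.col m) ^ 2 ≤ D.ε m ^ 2 := by
  obtain ⟨e, he, rfl⟩ := hh
  rw [add_sub_cancel_left]
  exact pow_le_pow_left₀ (norm_nonneg _) he 2

lemma channelVar_add_le {D : Scenario N M} {m : Fin M} (μ : FiniteMeasure (uncertainty D m)) :
    channelVar μ + μ.mass * l2 (channelMean μ - D.H.col m) ^ 2 ≤ D.ε m ^ 2 * μ.mass := by
  rw [← integral_l2_sub_sq, mul_comm, ← integral_finiteMeasure_const]
  refine integral_mono (integrable_of_continuous ?_ _) (integrable_const _)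
    fun h => l2_sub_col_sq_le h.2
  exact (continuous_l2.comp (by fun_prop)).pow 2

/-! ### Zero-forcing directions -/

section ComplProj

variable {ι : Type*} [Fintype ι] [DecidableEq ι] {H : Matrix ι (Fin M) ℂ} {m : Fin M}
  (hG : IsUnit ((removeCol H m)ᴴ * removeCol H m).det)
include hG

lemma conjTranspose_removeCol_mulVec_complProj (x : ι → ℂ) :
    (removeCol H m)ᴴ *ᵥ (complProj H m *ᵥ x) = 0 := by
  rw [mulVec_mulVec, complProj, Matrix.mul_sub, Matrix.mul_one, ← Matrix.mul_assoc,
    ← Matrix.mul_assoc, Matrix.mul_nonsing_inv _ hG, Matrix.one_mul, sub_self, zero_mulVec]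

lemma star_complProj_vecMul_removeCol (x : ι → ℂ) :
    star (complProj H m *ᵥ x) ᵥ* removeCol H m = 0 := by
  simpa [star_mulVec] using congrArg star (conjTranspose_removeCol_mulVec_complProj hG x)

lemma star_complProj_dotProduct_col (x : ι → ℂ) {j : Fin M} (hj : j ≠ m) :
    star (complProj H m *ᵥ x) ⬝ᵥ H.col j = 0 :=
  congrFun (star_complProj_vecMul_removeCol hG x) ⟨j, hj⟩

lemma star_complProj_dotProduct_self (x : ι → ℂ) :
    star (complProj H m *ᵥ x) ⬝ᵥ x = ((l2 (complProj H m *ᵥ x) ^ 2 : ℝ) : ℂ) := by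
  set y := (((removeCol H m)ᴴ * removeCol H m)⁻¹ * (removeCol H m)ᴴ) *ᵥ x
  have hx : complProj H m *ᵥ x = x - removeCol H m *ᵥ y := by
    rw [complProj, sub_mulVec, one_mulVec, mulVec_mulVec, ← Matrix.mul_assoc]
  have hy : star (complProj H m *ᵥ x) ⬝ᵥ (removeCol H m *ᵥ y) = 0 := by
    rw [dotProduct_mulVec, star_complProj_vecMul_removeCol hG, zero_dotProduct]
  rw [← star_dotProduct_self]
  nth_rw 3 [hx]
  rw [dotProduct_sub, hy, sub_zero]

end ComplProj

lemma star_extend_dotProduct {S : Finset (Fin N)} (v : S → ℂ) (x : Fin N → ℂ) :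
    star (Function.extend Subtype.val v 0) ⬝ᵥ x = star v ⬝ᵥ fun n => x n := by
  simp only [dotProduct, Pi.star_apply]
  rw [← Finset.sum_subset (Finset.subset_univ S) fun n _ hn => ?_, ← Finset.sum_coe_sort]
  · exact Finset.sum_congr rfl fun n _ => by rw [Subtype.val_injective.extend_apply]
  · rw [Function.extend_apply' _ _ _ fun ⟨k, hk⟩ => hn (hk ▸ k.2), Pi.zero_apply, star_zero,
      zero_mul]

lemma l2_extend {S : Finset (Fin N)} (v : S → ℂ) :
    l2 (Function.extend (Subtype.val : S → Fin N) v 0) = l2 v := by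
  have hsq : l2 (Function.extend (Subtype.val : S → Fin N) v 0) ^ 2 = l2 v ^ 2 := by
    refine Complex.ofReal_injective ?_
    rw [← star_dotProduct_self, ← star_dotProduct_self, star_extend_dotProduct]
    simp only [Subtype.val_injective.extend_apply]
  exact (sq_eq_sq₀ (norm_nonneg _) (norm_nonneg _)).1 hsq

/-- A beamforming direction for user `m` that does not use the antennas in `B` and causes no
interference at the nominal channels of the other users. It is normalized so that its gain at the
channel of user `m` is its squared norm, which has to be large compared to the channel error;
`(1 + 1 / M) * (M - 1)` is `M - 1 / M`. -/
structure IsZeroForcing (D : Scenario N M) (B : Finset (Fin N)) (m : Fin M) (u : Fin N → ℂ) :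
    Prop where
  apply_eq_zero : ∀ n ∈ B, u n = 0
  dotProduct_col_self : star u ⬝ᵥ D.H.col m = ((l2 u ^ 2 : ℝ) : ℂ)
  dotProduct_col_of_ne : ∀ j, j ≠ m → star u ⬝ᵥ D.H.col j = 0
  lt_l2_sq : D.ε m ^ 2 * ((1 + M) + (1 + 1 / M) * (M - 1) * D.γ m) < l2 u ^ 2

lemma exists_isZeroForcing {D : Scenario N M} {m : Fin M} (hε : 0 < D.ε m)
    (hD : ChannelCondition D L) {B : Finset (Fin N)} (hB : B.card + L ≤ N) :
    ∃ u, IsZeroForcing D B m u := by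
  have hcard : L ≤ (Bᶜ).card := by
    rw [Finset.card_compl, Fintype.card_fin]
    lia
  obtain ⟨hG, hbound⟩ := hD Bᶜ hcard m
  have hM : (0 : ℝ) < M := Nat.cast_pos.2 m.pos
  set v := complProj (subChannel D Bᶜ) m *ᵥ (subChannel D Bᶜ).col m
  refine ⟨Function.extend Subtype.val v 0, fun n hn => ?_, ?_, fun j hj => ?_, ?_⟩
  · exact Function.extend_apply' _ _ _ fun ⟨k, hk⟩ => Finset.mem_compl.1 k.2 (hk ▸ hn)
  · rw [star_extend_dotProduct, l2_extend]
    exact star_complProj_dotProduct_self hG _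
  · rw [star_extend_dotProduct]
    exact star_complProj_dotProduct_col hG _ hj
  · rw [gt_iff_lt, lt_div_iff₀ (pow_pos hε 2)] at hbound
    rw [l2_extend]
    refine lt_of_eq_of_lt ?_ hbound
    field_simp
    ring

lemma norm_sq_le_young {t : ℝ} (ht : 0 < t) (a b : ℂ) :
    ‖a‖ ^ 2 ≤ (1 + 1 / t) * ‖b‖ ^ 2 + (1 + t) * ‖b - a‖ ^ 2 := by
  have htri : ‖a‖ ≤ ‖b‖ + ‖b - a‖ := by
    simpa using norm_sub_le b (b - a)
  have hgap : 0 ≤ 1 / t * (‖b‖ - t * ‖b - a‖) ^ 2 := by positivity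
  calc ‖a‖ ^ 2 ≤ (‖b‖ + ‖b - a‖) ^ 2 := pow_le_pow_left₀ (norm_nonneg _) htri 2
    _ ≤ (‖b‖ + ‖b - a‖) ^ 2 + 1 / t * (‖b‖ - t * ‖b - a‖) ^ 2 := le_add_of_nonneg_right hgap
    _ = (1 + 1 / t) * ‖b‖ ^ 2 + (1 + t) * ‖b - a‖ ^ 2 := by
        field_simp
        ring

namespace IsZeroForcing

variable {D : Scenario N M} {B : Finset (Fin N)} {m : Fin M} {u : Fin N → ℂ}
  (hu : IsZeroForcing D B m u)
include hu

lemma l2_sq_pos (hγ : 0 < D.γ m) : 0 < l2 u ^ 2 := by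
  have hM : (0 : ℝ) ≤ M - 1 := sub_nonneg.2 (Nat.one_le_cast.2 m.pos)
  have hthreshold : 0 ≤ D.ε m ^ 2 * ((1 + M) + (1 + 1 / M) * (M - 1) * D.γ m) :=
    mul_nonneg (sq_nonneg _) (add_nonneg (by positivity)
      (mul_nonneg (mul_nonneg (by positivity) hM) hγ.le))
  exact hthreshold.trans_lt hu.lt_l2_sq

lemma vecMulVec_mem_psdCone : vecMulVec u (star u) ∈ psdCone B :=
  AntennaSelection.vecMulVec_mem_psdCone hu.apply_eq_zero

lemma norm_dotProduct_sq_le {j : Fin M} (hj : j ≠ m) {h : Fin N → ℂ} (hh : h ∈ uncertainty D j) :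
    ‖star u ⬝ᵥ h‖ ^ 2 ≤ D.ε j ^ 2 * l2 u ^ 2 := by
  have hsub : star u ⬝ᵥ h = star u ⬝ᵥ (h - D.H.col j) := by
    rw [dotProduct_sub, hu.dotProduct_col_of_ne j hj, sub_zero]
  rw [hsub, mul_comm]
  exact (norm_star_dotProduct_sq_le u _).trans
    (mul_le_mul_of_nonneg_left (l2_sub_col_sq_le hh) (sq_nonneg _))

lemma l2_sq_sub_le (hγ : 0 < D.γ m) (h : Fin N → ℂ) :
    l2 u ^ 2 - (1 + M) * l2 (h - D.H.col m) ^ 2 ≤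
      (1 + 1 / M) * (‖star u ⬝ᵥ h‖ ^ 2 / l2 u ^ 2) := by
  have hd := hu.l2_sq_pos hγ
  have hyoung := norm_sq_le_young (Nat.cast_pos.2 m.pos) (star u ⬝ᵥ D.H.col m) (star u ⬝ᵥ h)
  rw [← dotProduct_sub, hu.dotProduct_col_self, Complex.norm_real,
    Real.norm_of_nonneg hd.le] at hyoung
  have hcs : (1 + M : ℝ) * ‖star u ⬝ᵥ (h - D.H.col m)‖ ^ 2 ≤
      (1 + M) * (l2 u ^ 2 * l2 (h - D.H.col m) ^ 2) :=
    mul_le_mul_of_nonneg_left (norm_star_dotProduct_sq_le u _) (by positivity)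
  rw [← mul_div_assoc, le_div_iff₀ hd]
  linarith

end IsZeroForcing

lemma sum_erase_le {f : Fin M → ℝ} {m : Fin M} {c : ℝ} (hf : ∀ j ≠ m, f j ≤ c) :
    ∑ j ∈ Finset.univ.erase m, f j ≤ (M - 1) * c := by
  refine (Finset.sum_le_card_nsmul _ f c fun j hj => hf j (Finset.ne_of_mem_erase hj)).trans_eq ?_
  rw [Finset.card_erase_of_mem (Finset.mem_univ m), Finset.card_univ, Fintype.card_fin,
    nsmul_eq_mul, Nat.cast_pred m.pos]

lemma exists_nonneg_forall_le_mul {ι : Type*} [Finite ι] (a : ι → ℝ) {κ : ι → ℝ}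
    (hκ : ∀ i, 0 < κ i) : ∃ p, 0 ≤ p ∧ ∀ i, a i ≤ p * κ i := by
  have := Fintype.ofFinite ι
  have hterm (i : ι) : 0 ≤ |a i| / κ i := div_nonneg (abs_nonneg _) (hκ i).le
  refine ⟨∑ i, |a i| / κ i, Finset.sum_nonneg fun i _ => hterm i, fun i => ?_⟩
  refine (le_abs_self _).trans ((div_le_iff₀ (hκ i)).1 ?_)
  exact Finset.single_le_sum (f := fun i => |a i| / κ i) (fun i _ => hterm i) (Finset.mem_univ i)

section Slater

variable {D : Scenario N M} {B : Finset (Fin N)} {u : Fin M → Fin N → ℂ}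
  (hu : ∀ m, IsZeroForcing D B m (u m)) (hγ : ∀ m, 0 < D.γ m)
include hu hγ

lemma exists_pos_le_sinrMargin_zeroForcing (m : Fin M) :
    ∃ κ : ℝ, 0 < κ ∧ ∀ h,
      κ ≤ sinrMargin D (fun j => (l2 (u j) ^ 2)⁻¹ • vecMulVec (u j) (star (u j))) m h := by
  have hM : (0 : ℝ) < M := Nat.cast_pos.2 m.pos
  have hγm := hγ m
  refine ⟨(l2 (u m) ^ 2 - (1 + M) * D.ε m ^ 2) / (1 + 1 / M) - D.γ m * ((M - 1) * D.ε m ^ 2),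
    ?_, fun h => ?_⟩
  · rw [sub_pos, lt_div_iff₀ (by positivity)]
    linarith [(hu m).lt_l2_sq]
  · have hquad (j : Fin M) : quad ((l2 (u j) ^ 2)⁻¹ • vecMulVec (u j) (star (u j))) h =
        ‖star (u j) ⬝ᵥ h.1‖ ^ 2 / l2 (u j) ^ 2 := by
      rw [← quadOn_apply, map_smul, ContinuousMap.smul_apply, quadOn_apply, quad_vecMulVec,
        smul_eq_mul, inv_mul_eq_div]
    simp only [sinrMargin_apply, hquad]
    refine sub_le_sub ?_ (mul_le_mul_of_nonneg_left (sum_erase_le fun j hj => ?_) hγm.le)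
    · rw [div_le_iff₀' (by positivity)]
      refine le_trans ?_ ((hu m).l2_sq_sub_le hγm h)
      exact sub_le_sub_left (mul_le_mul_of_nonneg_left (l2_sub_col_sq_le h.2) (by positivity)) _
    · rw [div_le_iff₀ ((hu j).l2_sq_pos (hγ j))]
      exact (hu j).norm_dotProduct_sq_le hj.symm h.2

lemma exists_slater_point : ∃ X ∈ covCone M B, noiseMargin D + 1 ≤ sinrMargin D X := by
  choose κ hκ hmargin using exists_pos_le_sinrMargin_zeroForcing hu hγ
  obtain ⟨p, hp, hpκ⟩ := exists_nonneg_forall_le_mul (fun m => D.γ m * D.σ m ^ 2 + 1) hκ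
  refine ⟨p • fun j => (l2 (u j) ^ 2)⁻¹ • vecMulVec (u j) (star (u j)),
    (covCone M B).smul_mem hp (mem_covCone_iff.2 fun m =>
    (psdCone B).smul_mem (inv_nonneg.2 (sq_nonneg _)) (hu m).vecMulVec_mem_psdCone),
    fun m h => ?_⟩
  rw [map_smul]
  exact (hpκ m).trans (mul_le_mul_of_nonneg_left (hmargin m h) hp)

end Slater

/-! ### Rank-one solutions -/

/-- The dual price of a zero-forcing direction for its leakage to user `m`: `γ_m ε_m²` times the
total mass of the dual measure of user `m`. -/
def leakagePrice (D : Scenario N M) (μ : ∀ m, FiniteMeasure (uncertainty D m)) (m : Fin M) : ℝ :=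
  D.γ m * D.ε m ^ 2 * (μ m).mass

lemma leakagePrice_nonneg {D : Scenario N M} (μ : ∀ m, FiniteMeasure (uncertainty D m)) {m : Fin M}
    (hγ : 0 ≤ D.γ m) : 0 ≤ leakagePrice D μ m := by
  unfold leakagePrice
  positivity

namespace IsDualCertificate

variable {D : Scenario N M} {B : Finset (Fin N)} {X : Fin M → Matrix (Fin N) (Fin N) ℂ}
  {μ : ∀ m, FiniteMeasure (uncertainty D m)} (hμ : IsDualCertificate D B X μ)
include hμ

section ZeroForcing

variable (hγ : ∀ m, 0 < D.γ m)
include hγ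

lemma quadIntegral_zeroForcing_le {m : Fin M} {u : Fin N → ℂ} (hu : IsZeroForcing D B m u) :
    quadIntegral (μ m) (vecMulVec u (star u)) ≤
      l2 u ^ 2 * (1 + ∑ j ∈ Finset.univ.erase m, leakagePrice D μ j) := by
  have hslack := hμ.nonneg m _ hu.vecMulVec_mem_psdCone
  have hleak : ∑ j ∈ Finset.univ.erase m, D.γ j * quadIntegral (μ j) (vecMulVec u (star u)) ≤
      ∑ j ∈ Finset.univ.erase m, l2 u ^ 2 * leakagePrice D μ j := by
    refine Finset.sum_le_sum fun j hj => ?_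
    have hquad := quadIntegral_vecMulVec_le (μ j) fun h hh =>
      hu.norm_dotProduct_sq_le (Finset.ne_of_mem_erase hj) hh
    calc D.γ j * quadIntegral (μ j) (vecMulVec u (star u))
        ≤ D.γ j * (D.ε j ^ 2 * l2 u ^ 2 * (μ j).mass) := mul_le_mul_of_nonneg_left hquad (hγ j).le
      _ = l2 u ^ 2 * leakagePrice D μ j := by rw [leakagePrice]; ring
  rw [dualSlack_apply, trace_vecMulVec_star] at hslack
  rw [mul_add, mul_one, Finset.mul_sum]
  linarith

lemma mass_mul_l2_sq_le {m : Fin M} {u : Fin N → ℂ} (hu : IsZeroForcing D B m u) :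
    (μ m).mass * l2 u ^ 2 ≤
      (1 + 1 / M) * (1 + ∑ j ∈ Finset.univ.erase m, leakagePrice D μ j) +
        (1 + M) * (D.ε m ^ 2 * (μ m).mass - channelVar (μ m)) := by
  have hd := hu.l2_sq_pos (hγ m)
  have hgain : (μ m).mass * (‖star u ⬝ᵥ channelMean (μ m)‖ ^ 2 / l2 u ^ 2) ≤
      1 + ∑ j ∈ Finset.univ.erase m, leakagePrice D μ j := by
    rw [← mul_div_assoc, div_le_iff₀' hd]
    exact (mul_norm_dotProduct_channelMean_sq_le _ u).trans (hμ.quadIntegral_zeroForcing_le hγ hu)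
  have hmean := mul_le_mul_of_nonneg_left (hu.l2_sq_sub_le (hγ m) (channelMean (μ m)))
    (μ m).mass.coe_nonneg
  have hgain' := mul_le_mul_of_nonneg_left hgain (by positivity : (0 : ℝ) ≤ 1 + 1 / M)
  have hvar := mul_le_mul_of_nonneg_left (channelVar_add_le (μ m))
    (by positivity : (0 : ℝ) ≤ 1 + M)
  linarith

lemma leakagePrice_add_channelVar_lt {m : Fin M} {u : Fin N → ℂ} (hu : IsZeroForcing D B m u) :
    (M - 1) * leakagePrice D μ m + M * channelVar (μ m) <
      1 + ∑ j ∈ Finset.univ.erase m, leakagePrice D μ j := by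
  have hM : (0 : ℝ) < M := Nat.cast_pos.2 m.pos
  obtain hc | hc := (μ m).mass.coe_nonneg.eq_or_lt
  · have hvar := channelVar_add_le (μ m)
    have hprices := Finset.sum_nonneg fun j (_ : j ∈ Finset.univ.erase m) =>
      leakagePrice_nonneg μ (hγ j).le
    rw [← hc, zero_mul, mul_zero, add_zero] at hvar
    rw [leakagePrice, ← hc, mul_zero, mul_zero, zero_add]
    linarith [mul_nonpos_of_nonneg_of_nonpos hM.le hvar]
  · have hbound := (mul_lt_mul_of_pos_left hu.lt_l2_sq hc).trans_le (hμ.mass_mul_l2_sq_le hγ hu)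
    refine lt_of_mul_lt_mul_left ?_ (by positivity : (0 : ℝ) ≤ 1 + 1 / M)
    have hexpand : (1 + 1 / M) * ((M - 1) * leakagePrice D μ m + M * channelVar (μ m)) =
        (μ m).mass * (D.ε m ^ 2 * ((1 + M) + (1 + 1 / M) * (M - 1) * D.γ m)) -
          (1 + M) * (D.ε m ^ 2 * (μ m).mass - channelVar (μ m)) := by
      rw [leakagePrice]
      field_simp
      ring
    linarith

lemma channelVar_lt_one {u : Fin M → Fin N → ℂ} (hu : ∀ m, IsZeroForcing D B m (u m))
    (m : Fin M) : channelVar (μ m) < 1 := by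
  have hM : (0 : ℝ) < M := Nat.cast_pos.2 m.pos
  -- Summed over all users, the leakage prices on both sides of the inequality cancel.
  have hsum := Finset.sum_lt_sum_of_nonempty ⟨m, Finset.mem_univ m⟩ fun j _ =>
    hμ.leakagePrice_add_channelVar_lt hγ (hu j)
  simp only [Finset.sum_add_distrib, ← Finset.mul_sum, Finset.sum_erase_eq_sub (Finset.mem_univ _),
    Finset.sum_sub_distrib, Finset.sum_const, Finset.card_univ, Fintype.card_fin, nsmul_eq_mul,
    mul_one] at hsum
  have hlt : ∑ j, channelVar (μ j) < 1 := by
    refine lt_of_mul_lt_mul_left ?_ hM.le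
    linarith
  exact (Finset.single_le_sum (f := fun j => channelVar (μ j)) (fun j _ => channelVar_nonneg _)
    (Finset.mem_univ m)).trans_lt hlt

end ZeroForcing

lemma dualSlack_vecMulVec_nonpos {m : Fin M} (hX : X m ∈ psdCone B) {z : Fin N → ℂ}
    (hz : X m *ᵥ z ≠ 0) : dualSlack D μ m (vecMulVec (X m *ᵥ z) (star (X m *ᵥ z))) ≤ 0 := by
  set q := (star z ⬝ᵥ (X m *ᵥ z)).re
  have hq : 0 < q := re_dotProduct_mulVec_pos hX.1 hz
  have hrow : ∀ n ∈ B, (X m - q⁻¹ • vecMulVec (X m *ᵥ z) (star (X m *ᵥ z))) n = 0 := by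
    intro n hn
    ext k
    simp [vecMulVec_apply, mulVec, hX.2 n hn]
  have hslack := hμ.nonneg m _ ⟨posSemidef_sub_smul_vecMulVec hX.1 z, hrow⟩
  rw [map_sub, hμ.complementary, map_smul, zero_sub, smul_eq_mul, neg_nonneg] at hslack
  exact nonpos_of_mul_nonpos_right hslack (inv_pos.2 hq)

lemma one_le_channelVar_of_two_le_rank (hγ : ∀ m, 0 < D.γ m) {m : Fin M} (hX : X m ∈ psdCone B)
    (hr : 2 ≤ (X m).rank) : 1 ≤ channelVar (μ m) := by
  obtain ⟨z, hz, horth⟩ := exists_mulVec_ne_zero_dotProduct_eq_zero hr (star (channelMean (μ m)))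
  have horth' : star (X m *ᵥ z) ⬝ᵥ channelMean (μ m) = 0 := by
    rw [← norm_eq_zero, norm_star_dotProduct_comm, horth, norm_zero]
  have hslack := hμ.dualSlack_vecMulVec_nonpos hX hz
  have hleak := Finset.sum_nonneg fun j (_ : j ∈ Finset.univ.erase m) => mul_nonneg (hγ j).le
    (quadIntegral_nonneg (μ j) (posSemidef_vecMulVec_self_star (X m *ᵥ z)))
  rw [dualSlack_apply, trace_vecMulVec_star] at hslack
  refine le_of_mul_le_mul_left ?_ (pow_pos (l2_pos hz) 2)
  linarith [quadIntegral_vecMulVec_le_mul_channelVar (μ m) horth']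

end IsDualCertificate

lemma ne_zero_of_mem_sdrFeasible {D : Scenario N M} {B : Finset (Fin N)}
    {X : Fin M → Matrix (Fin N) (Fin N) ℂ} (hX : X ∈ sdrFeasible D B) {m : Fin M}
    (hγ : 0 < D.γ m) : X m ≠ 0 := by
  intro hzero
  have hqos := hX.2.1 m
  simp only [sdrQos, hzero, quad, zero_mulVec, dotProduct_zero, Complex.zero_re, zero_div,
    Real.iInf_const_zero] at hqos
  exact hqos.not_gt hγ

lemma one_le_rank {m n K : Type*} [Fintype n] [Field K] {X : Matrix m n K} (hX : X ≠ 0) :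
    1 ≤ X.rank := by
  obtain ⟨z, hz⟩ := exists_mulVec_ne_zero hX
  exact Submodule.one_le_finrank_iff.2 (Submodule.ne_bot_iff _ |>.2 ⟨X *ᵥ z, ⟨z, rfl⟩, hz⟩)

theorem solvedBySDR (D : Scenario N M) (hε : ∀ m, 0 < D.ε m) (hσ : ∀ m, 0 < D.σ m)
    (hγ : ∀ m, 0 < D.γ m) (hD : ChannelCondition D L) {B : Finset (Fin N)}
    (hB : B.card + L ≤ N) : SolvedBySDR D B := by
  choose u hu using fun m => exists_isZeroForcing (hε m) hD hB
  obtain ⟨X₀, hX₀, hslater⟩ := exists_slater_point hu hγ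
  refine solvedBySDR_of_rank D hε hσ B fun X hX m => le_antisymm ?_ ?_
  · obtain ⟨μ, hμ⟩ := exists_isDualCertificate hε hσ hX hX₀ hslater
    by_contra! hr
    exact (hμ.channelVar_lt_one hγ hu m).not_ge
      (hμ.one_le_channelVar_of_two_le_rank hγ ⟨hX.1.1 m, hX.1.2.2 m⟩ hr)
  · exact one_le_rank (ne_zero_of_mem_sdrFeasible hX.1 (hγ m))

/-! ### Shutting down the antennas of lowest power -/

lemma exists_lowest_subset {ι α : Type*} [LinearOrder α] (f : ι → α) (U : Finset ι) {k : ℕ}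
    (hk : k ≤ U.card) :
    ∃ C ⊆ U, C.card = k ∧ ∀ i ∈ C, ∀ j ∈ U, j ∉ C → f i ≤ f j := by
  classical
  induction k with
  | zero => exact ⟨∅, by simp⟩
  | succ k ih =>
    obtain ⟨C, hCU, hC, hle⟩ := ih (Nat.le_of_succ_le hk)
    have hne : (U \ C).Nonempty := Finset.sdiff_nonempty_of_card_lt_card (by lia)
    obtain ⟨a, ha, hmin⟩ := Finset.exists_min_image (U \ C) f hne
    rw [Finset.mem_sdiff] at ha
    refine ⟨insert a C, Finset.insert_subset ha.1 hCU, ?_, ?_⟩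
    · rw [Finset.card_insert_of_notMem ha.2, hC]
    · intro i hi j hj hjC
      rw [Finset.mem_insert, not_or] at hjC
      rcases Finset.mem_insert.1 hi with rfl | hi
      · exact hmin j (Finset.mem_sdiff.2 ⟨hj, hjC.2⟩)
      · exact hle i hi j hj hjC.2

lemma exists_isLowestPower (ν : Node N L) (W : Matrix (Fin N) (Fin M) ℂ) :
    ∃ C, IsLowestPower ν W C := by
  have hU : N - L - ν.B.card ≤ ((ν.A ∪ ν.B)ᶜ).card := by
    rw [Finset.card_compl, Fintype.card_fin, Finset.card_union_of_disjoint ν.disjoint]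
    have hcard := ν.card_A
    lia
  obtain ⟨C, hCU, hC, hle⟩ := exists_lowest_subset (fun i => l2 (W i) ^ 2) _ hU
  have hdisj : Disjoint C (ν.A ∪ ν.B) := Finset.subset_compl_iff_disjoint_right.1 hCU
  refine ⟨C, hdisj, ?_, fun i hi j hj hj' => hle i hi j (Finset.mem_compl.2 hj') hj⟩
  rw [Finset.card_union_of_disjoint (hdisj.mono_right Finset.subset_union_right), hC]
  have hcard := ν.card_B
  lia

lemma relaxFeasible_subset_nodeFeasible (D : Scenario N M) (c : CSI) (ν : Node N L)
    {C : Finset (Fin N)} (hC : (C ∪ ν.B).card = N - L) :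
    relaxFeasible D c (C ∪ ν.B) ⊆ nodeFeasible D c ν := by
  rintro W ⟨hqos, hrows⟩
  refine ⟨hqos, fun n hn => hrows n (Finset.mem_union_right _ hn), ?_⟩
  have hsub : {n | W n ≠ 0} ⊆ ((C ∪ ν.B)ᶜ : Finset (Fin N)) := fun n hn =>
    Finset.mem_coe.2 (Finset.mem_compl.2 fun hn' => hn (hrows n hn'))
  refine (Set.ncard_le_ncard hsub (Finset.finite_toSet _)).trans ?_
  rw [Set.ncard_coe_finset, Finset.card_compl, Fintype.card_fin, hC]
  exact tsub_tsub_le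

theorem validUpperBound (D : Scenario N M) (c : CSI) (ν : Node N L)
    {Solved : Finset (Fin N) → Prop} (hsolved : ∀ B : Finset (Fin N), B.card + L ≤ N → Solved B) :
    ValidUpperBound D c ν Solved := by
  refine fun W _ => ⟨exists_isLowestPower ν W, fun C hC => ?_⟩
  have hsub := relaxFeasible_subset_nodeFeasible D c ν hC.2.1
  refine ⟨hsolved _ ?_, optValue_le_optValue fun W hW => ⟨W, hsub hW, le_rfl⟩, hsub⟩
  rw [hC.2.1]
  have hcard := ν.card_B
  lia

end AntennaSelection

end

open AntennaSelection in
theorem lemma3 {N M L : ℕ} (D : Scenario N M)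
    (hσ : ∀ m, 0 < D.σ m) (hγ : ∀ m, 0 < D.γ m) :
    (∀ ν : Node N L, SolvedBySOCP D ν.B) ∧
    ((∀ m, 0 < D.ε m) → ChannelCondition D L → ∀ ν : Node N L, SolvedBySDR D ν.B) ∧
    (∀ ν : Node N L, ValidUpperBound D .BF ν (SolvedBySOCP D)) ∧
    ((∀ m, 0 < D.ε m) → ChannelCondition D L →
      ∀ ν : Node N L, ValidUpperBound D .RBF ν (SolvedBySDR D)) :=
  ⟨fun ν => solvedBySOCP D hσ hγ ν.B,
    fun hε hD ν => solvedBySDR D hε hσ hγ hD ν.card_B,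
    fun ν => validUpperBound D .BF ν fun B _ => solvedBySOCP D hσ hγ B,
    fun hε hD ν => validUpperBound D .RBF ν fun _ hB => solvedBySDR D hε hσ hγ hD hB⟩
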